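/- Let $(\phi_e)_{e\in\mathbb N}$ be any standard (acceptable) enumeration of the partial computable functions from $\mathbb N$ to $\mathbb N$, let $J$ be the partial computable function with $J(2^e(2x+1))=\phi_e(x)$ for all $e,x$ ($J(0)$ is undefined), and let $q:\mathbb N\to\mathbb N$ be a computable order, i.e. computable, non-decreasing and unbounded. Let $\mathcal{DNC}_q$ be the set of total functions $f:\mathbb N\to\mathbb N$ such that for all $n$: $f(n)\neq J(n)$ (trivially satisfied if $J(n)$ is undefined) and $f(n)<q(n)$. View $\mathcal{DNC}_q$ as a subset of $2^{\mathbb N}$ by writing the values $f(0),f(1),\dots$ one after the other, $f(n)$ in binary with $\lceil\log_2 q(n)\rceil$ digits. (i) Suppose that $\sum_n 1/q(n)<\infty$ and $\mathcal{DNC}_q\neq\emptyset$ (which is automatic if $q(n)\ge 2$ for all $n$). Then $\mathcal{DNC}_q$ is not tt-negligible: there is a computable measure $\mu$ on $2^{\mathbb N}$ with $\mu(\mathcal{DNC}_q)>0$. Moreover, let $X\in 2^{\mathbb N}$ be chosen according to the uniform measure, cut $X$ into consecutive blocks of lengths $\lfloor\log_2 q(n)\rfloor$, $n=0,1,\dots$,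 and let $f_X(n)$ be the number with binary expansion the $n$-th block. Then $f_X\in\mathcal{DNC}_q$ with positive probability. (ii) If $\sum_n 1/q(n)=\infty$, then $\mathcal{DNC}_q$ is deep: it is a $\Pi^0_1$ class and there is a computable order $h$ with $\sum_{\sigma\in T_n}\mathbf M(\sigma)\le 2^{-h(n)}$ for all $n$. Here $T_n$ is the set of strings of length $n$ that are prefixes of members of the class, and $\mathbf M$ is the universal lower semi-computable continuous semi-measure $\mathbf M(\sigma)=\lambda\{X : \widehat\Phi^X\succeq\sigma\}$, where $\lambda$ is the uniform measure on $2^{\mathbb N}$, $(\Phi_e)_{e}$ is an effective enumeration of all Turing functionals, and $\widehat\Phi(1^e0X)=\Phi_e(X)$. -/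

import Mathlib

open MeasureTheory
open scoped ENNReal

namespace DNCDepth

/-! ### Cantor space, the uniform measure, `Π⁰₁` classes -/

/-- The string `X ↾ n` of the first `n` bits of `X ∈ 2^ℕ`. -/
def restrict (X : ℕ → Bool) (n : ℕ) : List Bool := (List.range n).map X

/-- The cylinder `⟦σ⟧` of all sequences that have the prefix `σ`. -/
def cylinder (σ : List Bool) : Set (ℕ → Bool) := {X | restrict X σ.length = σ}

/-- The uniform (Lebesgue) measure `λ` on Cantor space: independent fair bits. -/
noncomputable def uniformMeasure : Measure (ℕ → Bool) :=
  Measure.infinitePi fun _ : ℕ => (PMF.uniformOfFintype Bool).toMeasure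

/-- An order function: non-decreasing and unbounded. -/
def IsOrder (h : ℕ → ℕ) : Prop := Monotone h ∧ ∀ b, ∃ n, b < h n

/-- `C` is a `Π⁰₁` class: its complement is `⟦S⟧` for a c.e. set `S` of strings. -/
def IsPi01 (C : Set (ℕ → Bool)) : Prop :=
  ∃ S : Set (List Bool), REPred (fun σ => σ ∈ S) ∧ Cᶜ = ⋃ σ ∈ S, cylinder σ

/-- The canonical co-c.e. tree of `C`: the strings `σ` with `⟦σ⟧ ∩ C ≠ ∅`. -/
def canonicalTree (C : Set (ℕ → Bool)) : Set (List Bool) :=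
  {σ | (cylinder σ ∩ C).Nonempty}

/-- The `n`-th level `T_n` of a tree `T`. -/
def level (T : Set (List Bool)) (n : ℕ) : Set (List Bool) := {σ | σ ∈ T ∧ σ.length = n}

/-! ### Turing functionals and the universal continuous semi-measure -/

/-- Comparable inputs are sent to comparable outputs. -/
def IsConsistent (Φ : Set (List Bool × List Bool)) : Prop :=
  ∀ p ∈ Φ, ∀ p' ∈ Φ, p.1 <+: p'.1 → p.2 <+: p'.2 ∨ p'.2 <+: p.2

/-- A Turing functional: a consistent c.e. set of pairs of strings. -/
def IsTuringFunctional (Φ : Set (List Bool × List Bool)) : Prop :=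
  REPred (fun p => p ∈ Φ) ∧ IsConsistent Φ

/-- The (finite) set of pairs that the `e`-th program accepts within `k` steps. -/
def enumStage (e k : ℕ) : Set (List Bool × List Bool) :=
  {p | (Nat.Partrec.Code.evaln k (Nat.Partrec.Code.ofNatCode e) (Encodable.encode p)).isSome}

/-- The effective list `(Φ_e)` of all Turing functionals: `Φ_e` enumerates the `e`-th c.e. set of
pairs of strings for as long as it stays consistent. -/
def functional (e : ℕ) : Set (List Bool × List Bool) :=
  {p | ∃ k, p ∈ enumStage e k ∧ IsConsistent (enumStage e k)}

theorem enumStage_mono (e : ℕ) {k l : ℕ} (h : k ≤ l) : enumStage e k ⊆ enumStage e l := by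
  intro p hp
  simp only [enumStage, Set.mem_ofPred_eq, Option.isSome_iff_exists] at hp ⊢
  obtain ⟨x, hx⟩ := hp
  exact ⟨x, Nat.Partrec.Code.evaln_mono h hx⟩

/-- Each `Φ_e` is consistent. -/
theorem functional_consistent (e : ℕ) : IsConsistent (functional e) := by
  rintro p ⟨k, hpk, hk⟩ p' ⟨l, hpl, hl⟩ h
  rcases le_total k l with hkl | hkl
  · exact hl p (enumStage_mono e hkl hpk) p' hpl h
  · exact hk p hpk p' (enumStage_mono e hkl hpl) h

/-- Each Turing functional occurs in the list. -/
theorem exists_functional_eq {Φ : Set (List Bool × List Bool)} (hΦ : IsTuringFunctional Φ) :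
    ∃ e, functional e = Φ := by
  obtain ⟨hre, hcons⟩ := hΦ
  obtain ⟨c, hc⟩ := Nat.Partrec.Code.exists_code.1 hre
  have key : ∀ p, p ∈ Φ ↔ ∃ k, p ∈ enumStage (Nat.Partrec.Code.encodeCode c) k := by
    intro p
    have hdom : (c.eval (Encodable.encode p)).Dom ↔ p ∈ Φ := by
      rw [hc]
      simp [Part.assert, Part.bind]
    have hcode : Nat.Partrec.Code.ofNatCode (Nat.Partrec.Code.encodeCode c) = c :=
      Denumerable.ofNat_encode c
    rw [← hdom]
    simp only [enumStage, Set.mem_ofPred_eq, hcode, Option.isSome_iff_exists]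
    constructor
    · intro h
      obtain ⟨k, hk⟩ := Nat.Partrec.Code.evaln_complete.1 (Part.get_mem h)
      exact ⟨k, _, hk⟩
    · rintro ⟨k, x, hx⟩
      exact Part.dom_iff_mem.2 ⟨x, Nat.Partrec.Code.evaln_sound hx⟩
  refine ⟨Nat.Partrec.Code.encodeCode c, Set.ext fun p => ⟨?_, ?_⟩⟩
  · rintro ⟨k, hk, -⟩
    exact (key p).2 ⟨k, hk⟩
  · intro hp
    obtain ⟨k, hk⟩ := (key p).1 hp
    exact ⟨k, hk, fun a ha b hb => hcons a ((key a).2 ⟨k, ha⟩) b ((key b).2 ⟨k, hb⟩)⟩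

/-- The universal Turing functional `Φ̂`, with `Φ̂(1^e 0 X) = Φ_e(X)`. -/
def universalFunctional : Set (List Bool × List Bool) :=
  {p | ∃ e α, p.1 = List.replicate e true ++ false :: α ∧ (α, p.2) ∈ functional e}

/-- `Φ^X ⪰ σ`. (With no pair that applies to `X` the output `Φ^X` is the empty string.) -/
def OutputExtends (Φ : Set (List Bool × List Bool)) (X : ℕ → Bool) (σ : List Bool) : Prop :=
  σ = [] ∨ ∃ n τ, (restrict X n, τ) ∈ Φ ∧ σ <+: τ

/-- The universal lower semi-computable continuous semi-measure (a priori probability)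
`M(σ) = λ {X | Φ̂^X ⪰ σ}`. -/
noncomputable def aprioriM (σ : List Bool) : ℝ≥0∞ :=
  uniformMeasure {X | OutputExtends universalFunctional X σ}

/-- `C` is a deep `Π⁰₁` class: `M(T_n) = ∑_{σ ∈ T_n} M(σ)` is at most `2^{-h(n)}` for a computable
order `h`, where `T` is the canonical co-c.e. tree of `C`. The inequality is not strict: at the root
`M` has the value `1`, so that `n = 0` would exclude every non-empty class. -/
def IsDeep (C : Set (ℕ → Bool)) : Prop :=
  IsPi01 C ∧ ∃ h : ℕ → ℕ, Computable h ∧ IsOrder h ∧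
    ∀ n, ∑' σ : level (canonicalTree C) n, aprioriM σ ≤ (2 : ℝ≥0∞)⁻¹ ^ h n

/-! ### Computable measures and tt-negligibility -/

/-- A measure on Cantor space is computable if some computable function yields, for a string `σ`
and a precision `i`, a dyadic rational `a / 2^b` within `2^{-i}` of the measure of `⟦σ⟧`. -/
def IsComputableMeasure (μ : Measure (ℕ → Bool)) : Prop :=
  ∃ a : List Bool × ℕ → ℕ × ℕ, Computable a ∧
    ∀ σ i, |μ.real (cylinder σ) - ((a (σ, i)).1 : ℝ) / 2 ^ (a (σ, i)).2| ≤ (1 / 2 : ℝ) ^ i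

/-- `C` is tt-negligible: `μ(C) = 0` for every computable measure `μ`. -/
def IsTTNegligible (C : Set (ℕ → Bool)) : Prop :=
  ∀ μ : Measure (ℕ → Bool), IsFiniteMeasure μ → IsComputableMeasure μ → μ C = 0

/-! ### Diagonally non-computable functions -/

/-- A standard (acceptable) enumeration `(φ_e)` of the partial computable functions on `ℕ`: it is
uniformly partial computable, and every uniformly partial computable sequence of functions
translates into it computably. -/
def IsStandardEnumeration (φ : ℕ → ℕ →. ℕ) : Prop :=
  Partrec₂ φ ∧ ∀ ψ : ℕ → ℕ →. ℕ, Partrec₂ ψ → ∃ f : ℕ → ℕ, Computable f ∧ ∀ i, φ (f i) = ψ i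

/-- Program codes give a standard enumeration. -/
theorem isStandardEnumeration_code :
    IsStandardEnumeration fun e => (Denumerable.ofNat Nat.Partrec.Code e).eval := by
  refine ⟨?_, fun ψ hψ => ?_⟩
  · exact Nat.Partrec.Code.eval_part.comp₂ ((Computable.ofNat _).comp Computable.fst) Computable.snd
  · have h : Partrec fun m : ℕ => ψ m.unpair.1 m.unpair.2 :=
      hψ.comp (Computable.fst.comp Computable.unpair) (Computable.snd.comp Computable.unpair)
    obtain ⟨c, hc⟩ := Nat.Partrec.Code.exists_code.1 (Partrec.nat_iff.1 h)
    refine ⟨fun i => Encodable.encode (Nat.Partrec.Code.curry c i), ?_, fun i => ?_⟩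
    · exact Computable.encode.comp (Nat.Partrec.Code.primrec₂_curry.to_comp.comp
        (Computable.const c) Computable.id)
    · funext x
      simp [Nat.Partrec.Code.eval_curry, hc]

/-- The universal partial computable function `J(2^e (2x+1)) = φ_e(x)`, undefined at `0`. -/
def J (φ : ℕ → ℕ →. ℕ) : ℕ →. ℕ := fun n =>
  if n = 0 then Part.none else φ (padicValNat 2 n) (n / 2 ^ (padicValNat 2 n + 1))

theorem J_zero (φ : ℕ → ℕ →. ℕ) : J φ 0 = Part.none := by simp [J]

theorem J_apply (φ : ℕ → ℕ →. ℕ) (e x : ℕ) : J φ (2 ^ e * (2 * x + 1)) = φ e x := by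
  have h : padicValNat 2 (2 ^ e * (2 * x + 1)) = e := by
    rw [padicValNat.mul (by positivity) (by positivity), padicValNat.prime_pow,
      padicValNat.eq_zero_of_not_dvd (by omega), add_zero]
  have h2 : 2 ^ e * (2 * x + 1) / 2 ^ (e + 1) = x := by
    rw [pow_succ, Nat.mul_div_mul_left _ _ (by positivity)]
    omega
  have h0 : 2 ^ e * (2 * x + 1) ≠ 0 := by positivity
  simp only [J, h, h2, if_neg h0]

/-- `DNC_q ⊆ ℕ^ℕ`: the functions `f` with `f(n) ≠ J(n)` (trivially true if `J(n)` is undefined) and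
`f(n) < q(n)` for all `n`. -/
def DNC (φ : ℕ → ℕ →. ℕ) (q : ℕ → ℕ) : Set (ℕ → ℕ) :=
  {f | ∀ n, f n ∉ J φ n ∧ f n < q n}

/-- Split `ℕ` into consecutive intervals `I_0, I_1, …` of lengths `r 0, r 1, …`; then `decode r X` is
the function that sends `n` to the index of `X ↾ I_n` in the lexicographic order of the strings of
length `r n`, that is, the number whose `r n`-digit binary expansion is `X ↾ I_n`. -/
def decode (r : ℕ → ℕ) (X : ℕ → Bool) (n : ℕ) : ℕ :=
  ∑ i ∈ Finset.range (r n),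
    (X ((∑ j ∈ Finset.range n, r j) + i)).toNat * 2 ^ (r n - 1 - i)

/-- `DNC_q` as a subset of Cantor space: `f` is coded by writing each `f(n)` in binary with
`⌈log₂ q(n)⌉` digits. -/
def DNCClass (φ : ℕ → ℕ →. ℕ) (q : ℕ → ℕ) : Set (ℕ → Bool) :=
  {X | decode (fun n => Nat.clog 2 (q n)) X ∈ DNC φ q}

end DNCDepth

/-!
If `∑ 1/q(n)` converges, the `n`-th block of `⌊log₂ q(n)⌋` fair bits hits `J(n)` with probability
at most `2 / q(n)`. Fix finitely many blocks according to a member of `DNC_q`, so that the remaining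
probabilities add up to less than `1`: conditioned on this choice, `J` is avoided with positive
probability. Padding the blocks with constant zeros to `⌈log₂ q(n)⌉` digits turns the uniform
measure into a computable product measure for which the class `DNC_q` is not null.

If `∑ 1/q(n)` diverges, so does the sum over the arguments `2^e (2j + 1)`, which `φ_e` controls.
By the recursion theorem `φ_e` knows its index, and at each of these arguments in turn it can search
for a value that is taken, with probability above `2^{-k} / q`, by an output of `Φ̂` that avoided
`φ_e` so far, and choose this value itself. The events killed in this way are disjoint and their
probabilities would add up to more than `1` after sufficiently many steps. Hence the search fails at
some argument; as there are only `q` values to choose from, an output survives that long with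
probability at most `2^{-k}`.
-/

namespace DNCDepth

/-! ### Computable functions and computably enumerable predicates -/

section Computability

variable {α β γ : Type*} [Primcodable α] [Primcodable β] [Primcodable γ]

attribute [fun_prop] Computable ComputablePred REPred Computable.const

@[fun_prop]
theorem computable_id : Computable fun a : α => a := Computable.id

@[fun_prop]
theorem computable_comp {f : β → γ} {g : α → β} (hf : Computable f) (hg : Computable g) :
    Computable fun a => f (g a) := hf.comp hg

@[fun_prop]
theorem computable_prodMk {f : α → β} {g : α → γ} (hf : Computable f) (hg : Computable g) :
    Computable fun a => (f a, g a) := hf.pair hg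

@[fun_prop]
theorem computable_fst {f : α → β × γ} (hf : Computable f) : Computable fun a => (f a).1 :=
  Computable.fst.comp hf

@[fun_prop]
theorem computable_snd {f : α → β × γ} (hf : Computable f) : Computable fun a => (f a).2 :=
  Computable.snd.comp hf

@[fun_prop]
theorem computable_add {f g : α → ℕ} (hf : Computable f) (hg : Computable g) :
    Computable fun a => f a + g a := Primrec.nat_add.to_comp.comp hf hg

@[fun_prop]
theorem computable_sub {f g : α → ℕ} (hf : Computable f) (hg : Computable g) :
    Computable fun a => f a - g a := Primrec.nat_sub.to_comp.comp hf hg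

@[fun_prop]
theorem computable_mul {f g : α → ℕ} (hf : Computable f) (hg : Computable g) :
    Computable fun a => f a * g a := Primrec.nat_mul.to_comp.comp hf hg

@[fun_prop]
theorem computable_div {f g : α → ℕ} (hf : Computable f) (hg : Computable g) :
    Computable fun a => f a / g a := Primrec.nat_div.to_comp.comp hf hg

@[fun_prop]
theorem computable_mod {f g : α → ℕ} (hf : Computable f) (hg : Computable g) :
    Computable fun a => f a % g a := Primrec.nat_mod.to_comp.comp hf hg

@[fun_prop]
theorem computable_pair {f g : α → ℕ} (hf : Computable f) (hg : Computable g) :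
    Computable fun a => Nat.pair (f a) (g a) := Primrec₂.natPair.to_comp.comp hf hg

@[fun_prop]
theorem computable_unpair {f : α → ℕ} (hf : Computable f) : Computable fun a => (f a).unpair :=
  Computable.unpair.comp hf

@[fun_prop]
theorem computable_encode {f : α → β} (hf : Computable f) :
    Computable fun a => Encodable.encode (f a) := Computable.encode.comp hf

@[fun_prop]
theorem computablePred_comp {p : β → Prop} {f : α → β} (hp : ComputablePred p)
    (hf : Computable f) : ComputablePred fun a => p (f a) := by
  obtain ⟨_, h⟩ := hp
  exact ⟨fun a => inferInstance, h.comp hf⟩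

@[fun_prop]
theorem computablePred_eq {f g : α → β} (hf : Computable f) (hg : Computable g) :
    ComputablePred fun a => f a = g a := by
  classical
  obtain ⟨_, h⟩ := Primrec.eq (α := β)
  exact ⟨fun a => inferInstance, (h.to_comp.comp (hf.pair hg)).of_eq fun a => by simp⟩

@[fun_prop]
theorem computablePred_le {f g : α → ℕ} (hf : Computable f) (hg : Computable g) :
    ComputablePred fun a => f a ≤ g a :=
  (computablePred_eq (computable_sub hf hg) (Computable.const 0)).of_eq fun _ =>
    Nat.sub_eq_zero_iff_le

@[fun_prop]
theorem computablePred_lt {f g : α → ℕ} (hf : Computable f) (hg : Computable g) :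
    ComputablePred fun a => f a < g a :=
  computablePred_le (f := fun a => f a + 1) (by fun_prop) hg

@[fun_prop]
theorem computablePred_not {p : α → Prop} (hp : ComputablePred p) :
    ComputablePred fun a => ¬ p a := hp.not

@[fun_prop]
theorem computablePred_and {p p' : α → Prop} (hp : ComputablePred p) (hp' : ComputablePred p') :
    ComputablePred fun a => p a ∧ p' a := by
  obtain ⟨_, h⟩ := hp
  obtain ⟨_, h'⟩ := hp'
  exact ⟨fun a => inferInstance, (Primrec.and.to_comp.comp h h').of_eq fun a => by simp⟩

@[fun_prop]
theorem computablePred_or {p p' : α → Prop} (hp : ComputablePred p) (hp' : ComputablePred p') :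
    ComputablePred fun a => p a ∨ p' a := by
  obtain ⟨_, h⟩ := hp
  obtain ⟨_, h'⟩ := hp'
  exact ⟨fun a => inferInstance, (Primrec.or.to_comp.comp h h').of_eq fun a => by simp⟩

@[fun_prop]
theorem computable_decide {p : α → Prop} [DecidablePred p] (hp : ComputablePred p) :
    Computable fun a => decide (p a) := hp.decide

@[fun_prop]
theorem computable_ite {p : α → Prop} [DecidablePred p] {f g : α → β} (hp : ComputablePred p)
    (hf : Computable f) (hg : Computable g) : Computable fun a => if p a then f a else g a := by
  simpa [Bool.cond_decide] using hp.decide.cond hf hg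

theorem computable_of_computablePred_le {f : α → ℕ}
    (hf : ComputablePred fun x : α × ℕ => f x.1 ≤ x.2) : Computable f := by
  classical
  refine (Computable.find hf fun a => ⟨f a, le_rfl⟩).of_eq fun a => ?_
  exact (Nat.find_eq_iff _).2 ⟨le_rfl, fun _ => not_le.2⟩

theorem exists_computable_choice {p : α → ℕ → Prop}
    (hp : ComputablePred fun x : α × ℕ => p x.1 x.2) (h : ∀ a, ∃ n, p a n) :
    ∃ f : α → ℕ, Computable f ∧ ∀ a, p a (f a) := by
  classical exact ⟨_, Computable.find hp h, fun a => Nat.find_spec (h a)⟩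

@[fun_prop]
theorem computable_sum {f : α → ℕ → ℕ} {n : α → ℕ} (hf : Computable fun x : α × ℕ => f x.1 x.2)
    (hn : Computable n) : Computable fun a => ∑ i ∈ Finset.range (n a), f a i := by
  refine (Computable.nat_rec (h := fun a (p : ℕ × ℕ) => p.2 + f a p.1) hn (Computable.const 0)
    (Computable.to₂ (f := fun x : α × ℕ × ℕ => x.2.2 + f x.1 x.2.1)
      (by fun_prop))).of_eq fun a => ?_
  induction n a with
  | zero => rfl
  | succ k ih => rw [Finset.sum_range_succ, ← ih]

@[fun_prop]
theorem computable_prod {f : α → ℕ → ℕ} {n : α → ℕ} (hf : Computable fun x : α × ℕ => f x.1 x.2)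
    (hn : Computable n) : Computable fun a => ∏ i ∈ Finset.range (n a), f a i := by
  refine (Computable.nat_rec (h := fun a (p : ℕ × ℕ) => p.2 * f a p.1) hn (Computable.const 1)
    (Computable.to₂ (f := fun x : α × ℕ × ℕ => x.2.2 * f x.1 x.2.1)
      (by fun_prop))).of_eq fun a => ?_
  induction n a with
  | zero => rfl
  | succ k ih => rw [Finset.prod_range_succ, ← ih]

@[fun_prop]
theorem computable_pow {f g : α → ℕ} (hf : Computable f) (hg : Computable g) :
    Computable fun a => f a ^ g a := by
  have h : Computable fun a => ∏ _i ∈ Finset.range (g a), f a := by fun_prop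
  simpa using h

theorem computable_natLog {b : ℕ} (hb : 1 < b) {f : α → ℕ} (hf : Computable f) :
    Computable fun a => Nat.log b (f a) := by
  refine computable_of_computablePred_le (ComputablePred.of_eq
    (p := fun x : α × ℕ => f x.1 < b ^ (x.2 + 1)) (by fun_prop) fun x => ?_)
  rw [← Nat.lt_add_one_iff]
  exact ⟨Nat.log_lt_of_lt_pow' (Nat.succ_ne_zero _), Nat.lt_pow_of_log_lt hb⟩

theorem computable_natClog {b : ℕ} (hb : 1 < b) {f : α → ℕ} (hf : Computable f) :
    Computable fun a => Nat.clog b (f a) :=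
  computable_of_computablePred_le (ComputablePred.of_eq
    (p := fun x : α × ℕ => f x.1 ≤ b ^ x.2) (by fun_prop) fun _ => (Nat.clog_le_iff_le_pow hb).symm)

@[fun_prop]
theorem computablePred_exists_lt {p : α → ℕ → Prop} {n : α → ℕ}
    (hp : ComputablePred fun x : α × ℕ => p x.1 x.2) (hn : Computable n) :
    ComputablePred fun a => ∃ i < n a, p a i := by
  classical
  have h : Computable fun a => ∑ i ∈ Finset.range (n a), if p a i then 1 else 0 := by fun_prop
  refine (computablePred_lt (Computable.const 0) h).of_eq fun a => ?_
  simp [Finset.filter_nonempty_iff]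

@[fun_prop]
theorem computablePred_forall_lt {p : α → ℕ → Prop} {n : α → ℕ}
    (hp : ComputablePred fun x : α × ℕ => p x.1 x.2) (hn : Computable n) :
    ComputablePred fun a => ∀ i < n a, p a i :=
  (computablePred_exists_lt (p := fun a i => ¬ p a i) hp.not hn).not.of_eq fun a => by simp

theorem computablePred_forall_encode_eq {p : α → β → Prop} {n : α → ℕ}
    (hp : ComputablePred fun x : α × β => p x.1 x.2) (hn : Computable n) :
    ComputablePred fun a => ∀ b, Encodable.encode b = n a → p a b := by
  classical
  have hc : Computable fun a => (Encodable.decode (α := β) (n a)).casesOn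
      (motive := fun _ => Bool) true fun b => decide (¬ Encodable.encode b = n a ∨ p a b) :=
    Computable.option_casesOn (Computable.decode.comp hn) (Computable.const true)
      (Computable.to₂ (f := fun y : α × β => decide (¬ Encodable.encode y.2 = n y.1 ∨ p y.1 y.2))
        (by fun_prop))
  refine (computablePred_eq hc (Computable.const true)).of_eq fun a => ?_
  cases hd : Encodable.decode (α := β) (n a) with
  | none => simpa using fun b hb => by simp [← hb] at hd
  | some b =>
    simp only [decide_eq_true_eq, ← imp_iff_not_or]
    refine ⟨fun H b' hb' => ?_, fun H => H b⟩
    obtain rfl : b' = b := by simpa [← hb'] using hd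
    exact H hb'

theorem computablePred_forall_encode_lt {p : α → β → Prop} {n : α → ℕ}
    (hp : ComputablePred fun x : α × β => p x.1 x.2) (hn : Computable n) :
    ComputablePred fun a => ∀ b, Encodable.encode b < n a → p a b := by
  have h : ComputablePred fun x : α × ℕ => ∀ b, Encodable.encode b = x.2 → p x.1 b :=
    computablePred_forall_encode_eq (p := fun (x : α × ℕ) b => p x.1 b) (by fun_prop) (by fun_prop)
  refine (computablePred_forall_lt (p := fun a i => ∀ b, Encodable.encode b = i → p a b)
    h hn).of_eq fun a => ?_
  exact ⟨fun H b hb => H _ hb b rfl, fun H i hi b hb => H b (hb ▸ hi)⟩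

@[fun_prop]
theorem rePred_of_computablePred {p : α → Prop} (hp : ComputablePred p) : REPred p := hp.to_re

@[fun_prop]
theorem rePred_ne {f g : α → β} (hf : Computable f) (hg : Computable g) :
    REPred fun a => f a ≠ g a := (computablePred_eq hf hg).not.to_re

@[fun_prop]
theorem rePred_comp {p : β → Prop} {f : α → β} (hp : REPred p) (hf : Computable f) :
    REPred fun a => p (f a) := Partrec.comp hp hf

@[fun_prop]
theorem rePred_and {p p' : α → Prop} (hp : REPred p) (hp' : REPred p') :
    REPred fun a => p a ∧ p' a := by
  have h : Partrec₂ fun (a : α) (_ : Unit) => Part.assert (p' a) fun _ => Part.some () :=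
    rePred_comp hp' Computable.fst
  exact (Partrec.bind hp h).dom_re.of_eq fun a => by simp [Part.dom_iff_mem]

@[fun_prop]
theorem rePred_or {p p' : α → Prop} (hp : REPred p) (hp' : REPred p') :
    REPred fun a => p a ∨ p' a := by
  obtain ⟨k, hk, h⟩ := Partrec.merge hp hp' fun _ _ _ _ _ => Subsingleton.elim _ _
  refine hk.dom_re.of_eq fun a => ?_
  simp [Part.dom_iff_mem, h]

theorem rePred_mem {f : α →. β} {g : α → β} (hf : Partrec f) (hg : Computable g) :
    REPred fun a => g a ∈ f a := by
  have h : Partrec₂ fun (a : α) (b : β) => Part.assert (b = g a) fun _ => Part.some () :=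
    (by fun_prop : REPred fun x : α × β => x.2 = g x.1)
  exact (Partrec.bind hf h).dom_re.of_eq fun a => by simp [Part.dom_iff_mem]

@[fun_prop]
theorem rePred_mem₂ {δ : Type*} [Primcodable δ] {f : β → γ →. δ} (hf : Partrec₂ f) {g : α → β}
    {h : α → γ} {k : α → δ} (hg : Computable g) (hh : Computable h) (hk : Computable k) :
    REPred fun a => k a ∈ f (g a) (h a) :=
  rePred_mem (f := fun a => f (g a) (h a)) (hf.comp hg hh) hk

theorem exists_primrec_stages {p : α → Prop} (hp : REPred p) :
    ∃ f : α → ℕ → Bool, Primrec₂ f ∧ (∀ a, Monotone (f a)) ∧ ∀ a, p a ↔ ∃ s, f a s = true := by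
  obtain ⟨c, hc⟩ := Nat.Partrec.Code.exists_code.1 hp
  refine ⟨fun a s => (Nat.Partrec.Code.evaln s c (Encodable.encode a)).isSome, ?_, ?_, fun a => ?_⟩
  · exact Primrec.option_isSome.comp (Nat.Partrec.Code.primrec_evaln.comp
      ((Primrec.snd.pair (Primrec.const c)).pair (Primrec.encode.comp Primrec.fst)))
  · intro a s t hst h
    obtain ⟨x, hx⟩ := Option.isSome_iff_exists.1 h
    exact Option.isSome_iff_exists.2 ⟨x, Nat.Partrec.Code.evaln_mono hst hx⟩
  · have hdom : p a ↔ (c.eval (Encodable.encode a)).Dom := by simp [hc, Part.assert, Part.bind]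
    simp only [hdom, Part.dom_iff_mem, Nat.Partrec.Code.evaln_complete, Option.isSome_iff_exists]
    exact exists_comm

/-- The search runs through all pairs of a candidate and a stage. -/
theorem exists_partrec_selector {R : α → β → Prop} (hR : REPred fun x : α × β => R x.1 x.2) :
    ∃ f : α →. β, Partrec f ∧ (∀ a, ∀ b ∈ f a, R a b) ∧ ∀ a, (f a).Dom ↔ ∃ b, R a b := by
  obtain ⟨g, hg, -, h⟩ := exists_primrec_stages hR
  let search (a : α) (s : ℕ) : Option β := (Encodable.decode (α := β) s.unpair.1).bind
    fun b => if g (a, b) s.unpair.2 = true then some b else none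
  have hsearch : Computable₂ search := by
    have hg' : Computable fun x : (α × β) × ℕ => g x.1 x.2 := hg.to_comp
    refine Computable.option_bind (f := fun x : α × ℕ => Encodable.decode (α := β) x.2.unpair.1)
      (Computable.decode.comp (by fun_prop)) (Computable.to₂ (f := fun y : (α × ℕ) × β =>
        if g (y.1.1, y.2) y.1.2.unpair.2 = true then some y.2 else none) ?_)
    exact computable_ite (by fun_prop) (Computable.option_some.comp (by fun_prop)) (by fun_prop)
  have hsound (a : α) (b : β) (hb : b ∈ Nat.rfindOpt (search a)) : R a b := by
    obtain ⟨s, hs⟩ := Nat.rfindOpt_spec hb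
    obtain ⟨b', -, hs⟩ := Option.bind_eq_some_iff.1 hs
    obtain ⟨hgs, hb'⟩ := Option.ite_none_right_eq_some.1 hs
    exact (h (a, b)).2 ⟨_, Option.some.inj hb' ▸ hgs⟩
  refine ⟨_, Partrec.rfindOpt hsearch, hsound,
    fun a => ⟨fun hd => ⟨_, hsound a _ (Part.get_mem hd)⟩, fun ⟨b, hb⟩ => ?_⟩⟩
  obtain ⟨s, hs⟩ := (h (a, b)).1 hb
  exact Nat.rfindOpt_dom.2 ⟨Nat.pair (Encodable.encode b) s, b, by simp [search, hs]⟩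

@[fun_prop]
theorem rePred_exists {p : α → β → Prop} (hp : REPred fun x : α × β => p x.1 x.2) :
    REPred fun a => ∃ b, p a b := by
  obtain ⟨f, hf, -, hdom⟩ := exists_partrec_selector hp
  exact hf.dom_re.of_eq hdom

@[fun_prop]
theorem rePred_forall_lt {p : α → ℕ → Prop} {n : α → ℕ} (hp : REPred fun x : α × ℕ => p x.1 x.2)
    (hn : Computable n) : REPred fun a => ∀ i < n a, p a i := by
  obtain ⟨g, hg, hmono, h⟩ := exists_primrec_stages hp
  have hg' : Computable fun x : (α × ℕ) × ℕ => g x.1 x.2 := hg.to_comp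
  have hstage : ComputablePred fun x : α × ℕ => ∀ i < n x.1, g (x.1, i) x.2 = true := by fun_prop
  refine (rePred_exists (p := fun a s => ∀ i < n a, g (a, i) s = true) hstage.to_re).of_eq
    fun a => ⟨fun ⟨s, hs⟩ i hi => (h (a, i)).2 ⟨s, hs i hi⟩, fun H => ?_⟩
  choose! s hs using fun i hi => (h (a, i)).1 (H i hi)
  refine ⟨(Finset.range (n a)).sup s, fun i hi => ?_⟩
  exact hmono (a, i) (Finset.le_sup (Finset.mem_range.2 hi)) (hs i hi)

end Computability

/-! ### The recursion theorem -/

/-- As `g i` is an index of `ψ i.unpair.2 (d i)`, where `d i` is an index of what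
`φ i.unpair.1` makes of `i`, the index `d (pair u k)` applies to itself once `φ u` computes `g`. -/
theorem IsStandardEnumeration.exists_computable_fixedPoint {φ : ℕ → ℕ →. ℕ}
    (hφ : IsStandardEnumeration φ) {ψ : ℕ → ℕ → ℕ →. ℕ}
    (hψ : Partrec fun x : ℕ × ℕ × ℕ => ψ x.1 x.2.1 x.2.2) :
    ∃ e : ℕ → ℕ, Computable e ∧ ∀ k, φ (e k) = ψ k (e k) := by
  obtain ⟨hp, ht⟩ := hφ
  have hp' {α : Type} [Primcodable α] {f g : α → ℕ} (hf : Computable f) (hg : Computable g) :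
      Partrec fun a => φ (f a) (g a) := hp.comp hf hg
  obtain ⟨d, hd, hφd⟩ := ht (fun i x => (φ i.unpair.1 i).bind fun y => φ y x)
    (Partrec.bind (hp' (f := fun x : ℕ × ℕ => x.1.unpair.1) (g := fun x => x.1)
      (by fun_prop) (by fun_prop)) (hp' (f := fun y : (ℕ × ℕ) × ℕ => y.2) (g := fun y => y.1.2)
      (by fun_prop) (by fun_prop)).to₂)
  obtain ⟨g, hg, hφg⟩ := ht (fun i => ψ i.unpair.2 (d i))
    (hψ.comp (g := fun x : ℕ × ℕ => (x.1.unpair.2, d x.1, x.2)) (by fun_prop))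
  obtain ⟨f, -, hφf⟩ := ht (fun _ i => Part.some (g i))
    (Computable.partrec (f := fun x : ℕ × ℕ => g x.2) (by fun_prop))
  refine ⟨fun k => d (Nat.pair (f 0) k), by fun_prop, fun k => ?_⟩
  rw [hφd]
  funext x
  simp [hφf, hφg]

/-! ### The universal functional -/

theorem restrict_length (X : ℕ → Bool) (n : ℕ) : (restrict X n).length = n := by simp [restrict]

theorem restrict_mem_cylinder (X : ℕ → Bool) (n : ℕ) : X ∈ cylinder (restrict X n) := by
  simp [cylinder, restrict_length]

theorem take_restrict (X : ℕ → Bool) {m n : ℕ} (h : m ≤ n) :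
    (restrict X n).take m = restrict X m := by
  simp [restrict, ← List.map_take, List.take_range, h]

theorem restrict_prefix (X : ℕ → Bool) {m n : ℕ} (h : m ≤ n) : restrict X m <+: restrict X n :=
  take_restrict X h ▸ List.take_prefix _ _

/-- The sequence `τ000…`. -/
def extendByZeros (τ : List Bool) (i : ℕ) : Bool := τ.getD i false

theorem mem_cylinder_iff {X : ℕ → Bool} {σ : List Bool} :
    X ∈ cylinder σ ↔ ∀ i < σ.length, X i = extendByZeros σ i := by
  refine ⟨fun h i hi => ?_, fun h => List.ext_getElem (restrict_length _ _) fun i hi hi' => ?_⟩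
  · rw [← show restrict X σ.length = σ from h]
    simp [extendByZeros, restrict, hi]
  · simpa [extendByZeros, restrict, hi'] using h i hi'

section UniversalFunctional

variable {α : Type*} [Primcodable α]

@[fun_prop]
theorem computable_listLength {β : Type*} [Primcodable β] {f : α → List β} (hf : Computable f) :
    Computable fun a => (f a).length := Computable.list_length.comp hf

@[fun_prop]
theorem computable_listTake {β : Type*} [Primcodable β] {f : α → ℕ} {g : α → List β}
    (hf : Computable f) (hg : Computable g) : Computable fun a => (g a).take (f a) :=
  Primrec.list_take.to_comp.comp hf hg

@[fun_prop]
theorem computable_listCons {β : Type*} [Primcodable β] {f : α → β} {g : α → List β}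
    (hf : Computable f) (hg : Computable g) : Computable fun a => f a :: g a :=
  Computable.list_cons.comp hf hg

@[fun_prop]
theorem computable_listAppend {β : Type*} [Primcodable β] {f g : α → List β}
    (hf : Computable f) (hg : Computable g) : Computable fun a => f a ++ g a :=
  Computable.list_append.comp hf hg

@[fun_prop]
theorem computable_listReplicate {β : Type*} [Primcodable β] {f : α → ℕ} {g : α → β}
    (hf : Computable f) (hg : Computable g) : Computable fun a => List.replicate (f a) (g a) := by
  have h : Primrec₂ fun (n : ℕ) (b : β) => List.replicate n b :=
    (Primrec.list_map (Primrec.list_range.comp Primrec.fst)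
      (Primrec.snd.comp Primrec.fst).to₂).of_eq fun x => by simp
  exact h.to_comp.comp hf hg

@[fun_prop]
theorem computable_extendByZeros {f : α → List Bool} {g : α → ℕ}
    (hf : Computable f) (hg : Computable g) : Computable fun a => extendByZeros (f a) (g a) :=
  (Primrec.list_getD false).to_comp.comp hf hg

@[fun_prop]
theorem computablePred_isPrefix {β : Type*} [Primcodable β] {f g : α → List β} (hf : Computable f)
    (hg : Computable g) : ComputablePred fun a => f a <+: g a :=
  ComputablePred.of_eq (p := fun a => f a = (g a).take (f a).length) (by fun_prop)
    fun _ => List.prefix_iff_eq_take.symm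

@[fun_prop]
theorem computablePred_mem_enumStage {e k : α → ℕ} {p : α → List Bool × List Bool}
    (he : Computable e) (hk : Computable k) (hp : Computable p) :
    ComputablePred fun a => p a ∈ enumStage (e a) (k a) := by
  have h : Computable fun a => (Nat.Partrec.Code.evaln (k a)
      (Nat.Partrec.Code.ofNatCode (e a)) (Encodable.encode (p a))).isSome :=
    Primrec.option_isSome.to_comp.comp (Nat.Partrec.Code.primrec_evaln.to_comp.comp
      ((hk.pair ((Computable.ofNat Nat.Partrec.Code).comp he)).pair (Computable.encode.comp hp)))
  exact computablePred_eq h (Computable.const true)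

theorem encode_lt_of_mem_enumStage {e k : ℕ} {p : List Bool × List Bool} (h : p ∈ enumStage e k) :
    Encodable.encode p < k := by
  obtain ⟨x, hx⟩ := Option.isSome_iff_exists.1 (show _ = true from h)
  exact Nat.Partrec.Code.evaln_bound hx

@[fun_prop]
theorem computablePred_isConsistent_enumStage {e k : α → ℕ} (he : Computable e)
    (hk : Computable k) : ComputablePred fun a => IsConsistent (enumStage (e a) (k a)) := by
  let Clash (a : α) (p p' : List Bool × List Bool) : Prop := p ∈ enumStage (e a) (k a) ∧
    p' ∈ enumStage (e a) (k a) ∧ p.1 <+: p'.1 ∧ ¬ p.2 <+: p'.2 ∧ ¬ p'.2 <+: p.2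
  have h : ComputablePred fun x : (α × List Bool × List Bool) × List Bool × List Bool =>
      ¬ Clash x.1.1 x.1.2 x.2 := by simp only [Clash]; fun_prop
  refine (computablePred_forall_encode_lt (p := fun a p =>
      ∀ p', Encodable.encode p' < k a → ¬ Clash a p p') (computablePred_forall_encode_lt
    (p := fun (x : α × List Bool × List Bool) p' => ¬ Clash x.1 x.2 p') h (by fun_prop))
    hk).of_eq fun a => ?_
  have hiff (p p') : ¬ Clash a p p' ↔ (p ∈ enumStage (e a) (k a) → p' ∈ enumStage (e a) (k a) →
      p.1 <+: p'.1 → p.2 <+: p'.2 ∨ p'.2 <+: p.2) := by tauto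
  simp only [hiff]
  exact ⟨fun H p hp p' hp' => H p (encode_lt_of_mem_enumStage hp) p'
    (encode_lt_of_mem_enumStage hp') hp hp', fun H p _ p' _ hp hp' => H p hp p' hp'⟩

@[fun_prop]
theorem rePred_mem_functional {e : α → ℕ} {p : α → List Bool × List Bool} (he : Computable e)
    (hp : Computable p) : REPred fun a => p a ∈ functional (e a) := by
  have h : ComputablePred fun x : α × ℕ =>
      p x.1 ∈ enumStage (e x.1) x.2 ∧ IsConsistent (enumStage (e x.1) x.2) := by fun_prop
  exact rePred_exists (p := fun a k => p a ∈ enumStage (e a) k ∧ IsConsistent (enumStage (e a) k))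
    h.to_re

@[fun_prop]
theorem rePred_mem_universalFunctional {p : α → List Bool × List Bool} (hp : Computable p) :
    REPred fun a => p a ∈ universalFunctional := by
  have h : REPred fun a => ∃ e α, (p a).1 = List.replicate e true ++ false :: α ∧
      (α, (p a).2) ∈ functional e := by fun_prop
  exact h

theorem replicate_append_prefix {e e' : ℕ} {α α' : List Bool}
    (h : List.replicate e true ++ false :: α <+: List.replicate e' true ++ false :: α') :
    e = e' ∧ α <+: α' := by
  induction e generalizing e' with
  | zero => cases e' <;> simp_all [List.replicate_succ]
  | succ e ih =>
    cases e' with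
    | zero => simp [List.replicate_succ] at h
    | succ e' =>
      simp only [List.replicate_succ, List.cons_append, List.cons_prefix_cons, true_and] at h
      exact ⟨congrArg (· + 1) (ih h).1, (ih h).2⟩

theorem isConsistent_universalFunctional : IsConsistent universalFunctional := by
  rintro ⟨β, τ⟩ ⟨e, α, (rfl : β = _), h⟩ ⟨β', τ'⟩ ⟨e', α', (rfl : β' = _), h'⟩ hpre
  obtain ⟨rfl, hα⟩ := replicate_append_prefix hpre
  exact functional_consistent e (α, τ) h (α', τ') h' hα

end UniversalFunctional

/-! ### Product measures with constant and fair bits -/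

/-- The sequences that agree with `τ` on the finite set `I` of positions. -/
def box (I : Finset ℕ) (τ : ℕ → Bool) : Set (ℕ → Bool) := {X | ∀ i ∈ I, X i = τ i}

/-- The distribution of independent bits of which the `i`-th is constantly `0` if `P i` holds and
fair otherwise. -/
noncomputable def paddedMeasure (P : ℕ → Bool) : Measure (ℕ → Bool) :=
  Measure.infinitePi fun i => bif P i then Measure.dirac false
    else (PMF.uniformOfFintype Bool).toMeasure

instance isProbabilityMeasure_paddedBit (b : Bool) : IsProbabilityMeasure
    (bif b then Measure.dirac false else (PMF.uniformOfFintype Bool).toMeasure) := by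
  cases b <;> simp only [cond_true, cond_false] <;> infer_instance

instance isProbabilityMeasure_paddedMeasure (P : ℕ → Bool) :
    IsProbabilityMeasure (paddedMeasure P) := by
  unfold paddedMeasure
  infer_instance

theorem uniformMeasure_eq_paddedMeasure : uniformMeasure = paddedMeasure fun _ => false := rfl

instance isProbabilityMeasure_uniformMeasure : IsProbabilityMeasure uniformMeasure :=
  isProbabilityMeasure_paddedMeasure fun _ => false

theorem paddedMeasure_box (P : ℕ → Bool) (I : Finset ℕ) (τ : ℕ → Bool) :
    paddedMeasure P (box I τ) =
      ∏ i ∈ I, bif P i then (bif τ i then 0 else 1) else (2 : ℝ≥0∞)⁻¹ := by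
  have hbit (b c : Bool) : (bif b then Measure.dirac false
      else (PMF.uniformOfFintype Bool).toMeasure) {c} =
      bif b then (bif c then 0 else 1) else (2 : ℝ≥0∞)⁻¹ := by
    cases b
    · simp [PMF.toMeasure_apply_singleton _ _ (measurableSet_singleton c)]
    · cases c <;> simp
  refine (Measure.infinitePi_pi (fun i => bif P i then Measure.dirac false
    else (PMF.uniformOfFintype Bool).toMeasure) (s := I) (t := fun i => {τ i})
    fun i _ => measurableSet_singleton _).trans ?_
  simp only [hbit]

theorem measurableSet_box (I : Finset ℕ) (τ : ℕ → Bool) : MeasurableSet (box I τ) :=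
  MeasurableSet.pi (s := (I : Set ℕ)) (t := fun i => {τ i}) I.countable_toSet
    fun _ _ => measurableSet_singleton _

theorem cylinder_eq_box (σ : List Bool) :
    cylinder σ = box (Finset.range σ.length) (extendByZeros σ) := by
  ext X
  simp only [mem_cylinder_iff, box, Finset.mem_range, Set.mem_ofPred_eq]

theorem measurableSet_cylinder (σ : List Bool) : MeasurableSet (cylinder σ) := by
  rw [cylinder_eq_box]
  exact measurableSet_box _ _

theorem uniformMeasure_cylinder (σ : List Bool) :
    uniformMeasure (cylinder σ) = (2 : ℝ≥0∞)⁻¹ ^ σ.length := by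
  rw [cylinder_eq_box, uniformMeasure_eq_paddedMeasure, paddedMeasure_box]
  simp

theorem measurableSet_exists_restrict (p : List Bool → Prop) :
    MeasurableSet {X | ∃ n, p (restrict X n)} := by
  have h : {X | ∃ n, p (restrict X n)} = ⋃ σ ∈ {σ | p σ}, cylinder σ := by
    ext X
    simp only [Set.mem_ofPred_eq, Set.mem_iUnion, exists_prop]
    exact ⟨fun ⟨n, hn⟩ => ⟨_, hn, restrict_mem_cylinder X n⟩,
      fun ⟨σ, hσ, (hX : restrict X σ.length = σ)⟩ => ⟨σ.length, by rwa [hX]⟩⟩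
  rw [h]
  exact MeasurableSet.biUnion (Set.to_countable _) fun σ _ => measurableSet_cylinder σ

theorem isComputableMeasure_paddedMeasure {P : ℕ → Bool} (hP : Computable P) :
    IsComputableMeasure (paddedMeasure P) := by
  classical
  let a (σ : List Bool) : ℕ :=
    ∏ i ∈ Finset.range σ.length, if P i = true ∧ extendByZeros σ i = true then 0 else 1
  let b (σ : List Bool) : ℕ := ∑ i ∈ Finset.range σ.length, if P i = true then 0 else 1
  have hμ (σ : List Bool) : (paddedMeasure P).real (cylinder σ) = a σ / 2 ^ b σ := by
    rw [cylinder_eq_box, Measure.real, paddedMeasure_box, ENNReal.toReal_prod, Nat.cast_prod,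
      ← Finset.prod_pow_eq_pow_sum, ← Finset.prod_div_distrib]
    refine Finset.prod_congr rfl fun i _ => ?_
    cases P i <;> cases extendByZeros σ i <;> simp
  refine ⟨fun x => (a x.1, b x.1), by fun_prop, fun σ i => ?_⟩
  rw [hμ, sub_self, abs_zero]
  positivity

/-! ### Lower semi-computability of the measure of a c.e. open set -/

@[fun_prop]
theorem computable_restrict {α : Type*} [Primcodable α] {X : α → ℕ → Bool} {n : α → ℕ}
    (hX : Computable fun x : α × ℕ => X x.1 x.2) (hn : Computable n) :
    Computable fun a => restrict (X a) (n a) := by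
  have hstep : Computable fun x : α × ℕ × List Bool => x.2.2 ++ [X x.1 x.2.1] := by fun_prop
  refine (Computable.nat_rec hn (Computable.const []) hstep.to₂).of_eq fun a => ?_
  induction n a with
  | zero => rfl
  | succ n ih => simpa [restrict, List.range_succ] using ih

theorem exists_restrict_testBit_eq (X : ℕ → Bool) (s : ℕ) :
    ∃ v < 2 ^ s, restrict (Nat.testBit v) s = restrict X s :=
  ⟨Nat.ofBits fun i : Fin s => X i, Nat.ofBits_lt_two_pow _,
    List.map_congr_left fun _ hi => Nat.testBit_ofBits_lt _ _ (List.mem_range.1 hi)⟩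

theorem restrict_testBit_injOn (s : ℕ) :
    Set.InjOn (fun v => restrict (Nat.testBit v) s) (Set.Iio (2 ^ s)) := by
  refine fun v hv w hw h => Nat.eq_of_testBit_eq fun i => ?_
  rcases lt_or_ge i s with hi | hi
  · exact List.map_inj_left.1 h i (List.mem_range.2 hi)
  · have hpow := Nat.pow_le_pow_right two_pos hi
    rw [Nat.testBit_lt_two_pow (hv.trans_le hpow), Nat.testBit_lt_two_pow (hw.trans_le hpow)]

theorem uniformMeasure_setOf_eq_sum {s : ℕ} {p : (ℕ → Bool) → Prop} [DecidablePred p]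
    (hp : ∀ X Y, restrict X s = restrict Y s → p X → p Y) :
    uniformMeasure {X | p X} =
      (∑ v ∈ Finset.range (2 ^ s), if p (Nat.testBit v) then 1 else 0 : ℕ) *
        (2 : ℝ≥0∞)⁻¹ ^ s := by
  let V := {v ∈ Finset.range (2 ^ s) | p (Nat.testBit v)}
  have hcyl (v : ℕ) (X : ℕ → Bool) : X ∈ cylinder (restrict (Nat.testBit v) s) ↔
      restrict X s = restrict (Nat.testBit v) s := by
    simp [cylinder, restrict_length]
  have hV : {X | p X} = ⋃ v ∈ V, cylinder (restrict (Nat.testBit v) s) := by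
    ext X
    simp only [Set.mem_ofPred_eq, Set.mem_iUnion, hcyl, exists_prop, V, Finset.mem_filter,
      Finset.mem_range]
    refine ⟨fun hX => ?_, fun ⟨v, ⟨_, hv⟩, hX⟩ => hp _ _ hX.symm hv⟩
    obtain ⟨v, hv, hvX⟩ := exists_restrict_testBit_eq X s
    exact ⟨v, ⟨hv, hp _ _ hvX.symm hX⟩, hvX.symm⟩
  have hdisj : (V : Set ℕ).PairwiseDisjoint fun v => cylinder (restrict (Nat.testBit v) s) := by
    refine fun v hv w hw hvw => Set.disjoint_left.2 fun X hX hX' => hvw ?_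
    simp only [V, Finset.coe_filter, Finset.mem_range, Set.mem_ofPred_eq] at hv hw
    exact restrict_testBit_injOn s hv.1 hw.1 (((hcyl v X).1 hX).symm.trans ((hcyl w X).1 hX'))
  rw [hV, measure_biUnion_finset hdisj fun _ _ => measurableSet_cylinder _]
  simp only [uniformMeasure_cylinder, restrict_length, Finset.sum_const, nsmul_eq_mul, V,
    Finset.card_filter]

@[fun_prop]
theorem computable_testBit {α : Type*} [Primcodable α] {f g : α → ℕ} (hf : Computable f)
    (hg : Computable g) : Computable fun a => Nat.testBit (f a) (g a) :=
  (computable_decide (p := fun a => f a / 2 ^ g a % 2 = 1) (by fun_prop)).of_eq fun a =>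
    Nat.testBit_eq_decide_div_mod_eq.symm

theorem rePred_lt_mul_uniformMeasure {β : Type*} [Primcodable β] {B : β → List Bool → Prop}
    {m c : β → ℕ} (hB : REPred fun x : β × List Bool => B x.1 x.2) (hm : Computable m)
    (hc : Computable c) :
    REPred fun b => (m b : ℝ≥0∞) < c b * uniformMeasure {X | ∃ n, B b (restrict X n)} := by
  classical
  obtain ⟨f, hf, hmono, hfB⟩ := exists_primrec_stages hB
  have hB' (b w) : B b w ↔ ∃ s, f (b, w) s = true := hfB (b, w)
  have hf' : Computable fun x : (β × List Bool) × ℕ => f x.1 x.2 := hf.to_comp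
  let R (b : β) (s : ℕ) (X : ℕ → Bool) : Prop := ∃ n < s + 1, f (b, restrict X n) s = true
  have hRs (b : β) (s : ℕ) (X Y) (hXY : restrict X s = restrict Y s) : R b s X → R b s Y := by
    rintro ⟨n, hn, hX⟩
    rw [← take_restrict X (Nat.lt_succ_iff.1 hn), hXY, take_restrict Y (Nat.lt_succ_iff.1 hn)] at hX
    exact ⟨n, hn, hX⟩
  have hRmono (b : β) : Monotone fun s => {X | R b s X} := fun s t hst X ⟨n, hn, hX⟩ =>
    ⟨n, by omega, hmono _ hst hX⟩
  have hU (b : β) : {X | ∃ n, B b (restrict X n)} = ⋃ s, {X | R b s X} := by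
    ext X
    simp only [Set.mem_ofPred_eq, Set.mem_iUnion, hB']
    refine ⟨fun ⟨n, s, hs⟩ => ⟨max s n, n, by omega, hmono _ (le_max_left _ _) hs⟩,
      fun ⟨s, n, _, hs⟩ => ⟨n, s, hs⟩⟩
  have hdec : ComputablePred fun x : β × ℕ => m x.1 * 2 ^ x.2 < c x.1 *
      ∑ v ∈ Finset.range (2 ^ x.2), if R x.1 x.2 (Nat.testBit v) then 1 else 0 := by
    simp only [R]
    fun_prop
  refine (rePred_exists (p := fun b s => m b * 2 ^ s < c b * ∑ v ∈ Finset.range (2 ^ s),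
    if R b s (Nat.testBit v) then 1 else 0) hdec.to_re).of_eq fun b => ?_
  rw [hU, (hRmono b).measure_iUnion, ENNReal.mul_iSup, lt_iSup_iff]
  refine exists_congr fun s => ?_
  rw [uniformMeasure_setOf_eq_sum (hRs b s), ← ENNReal.inv_pow, ← mul_assoc, ← div_eq_mul_inv,
    ENNReal.lt_div_iff_mul_lt (Or.inl (by simp)) (Or.inl (by simp))]
  norm_cast

/-! ### Blocks of binary digits -/

/-- The number with the binary expansion `b 0, …, b (r - 1)`, most significant digit first. -/
def binaryValue (b : ℕ → Bool) (r : ℕ) : ℕ :=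
  ∑ i ∈ Finset.range r, (b i).toNat * 2 ^ (r - 1 - i)

theorem binaryValue_succ (b : ℕ → Bool) (r : ℕ) :
    binaryValue b (r + 1) = 2 * binaryValue b r + (b r).toNat := by
  rw [binaryValue, Finset.sum_range_succ, binaryValue, Finset.mul_sum]
  congr 1
  · refine Finset.sum_congr rfl fun i hi => ?_
    rw [Finset.mem_range] at hi
    rw [show r + 1 - 1 - i = r - 1 - i + 1 by omega, pow_succ]
    ring
  · simp

theorem binaryValue_congr {b c : ℕ → Bool} {r : ℕ} (h : ∀ i < r, b i = c i) :
    binaryValue b r = binaryValue c r :=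
  Finset.sum_congr rfl fun i hi => by rw [h i (Finset.mem_range.1 hi)]

theorem eq_of_binaryValue_eq {b c : ℕ → Bool} {r : ℕ} (h : binaryValue b r = binaryValue c r) :
    ∀ i < r, b i = c i := by
  induction r with
  | zero => simp
  | succ r ih =>
    rw [binaryValue_succ, binaryValue_succ] at h
    have hb := Bool.toNat_le (b r)
    have hc := Bool.toNat_le (c r)
    intro i hi
    rcases Nat.lt_succ_iff_lt_or_eq.1 hi with hi | rfl
    · exact ih (by omega) i hi
    · have hbit : (b i).toNat = (c i).toNat := by omega
      revert hbit
      cases b i <;> cases c i <;> simp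

theorem binaryValue_eq_zero {b : ℕ → Bool} {r : ℕ} (h : ∀ i < r, b i = false) :
    binaryValue b r = 0 :=
  Finset.sum_eq_zero fun i hi => by simp [h i (Finset.mem_range.1 hi)]

theorem binaryValue_add_lt {b : ℕ → Bool} {s : ℕ} (h : ∀ i < s, b i = false) (t : ℕ) :
    binaryValue b (s + t) < 2 ^ t := by
  induction t with
  | zero => simp [binaryValue_eq_zero h]
  | succ t ih =>
    rw [← add_assoc, binaryValue_succ, pow_succ]
    have := Bool.toNat_le (b (s + t))
    omega

theorem exists_binaryValue_add_eq (s : ℕ) {t v : ℕ} (hv : v < 2 ^ t) :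
    ∃ b : ℕ → Bool, (∀ i < s, b i = false) ∧ binaryValue b (s + t) = v := by
  induction t generalizing v with
  | zero =>
    obtain rfl : v = 0 := by simpa using hv
    exact ⟨fun _ => false, fun _ _ => rfl, binaryValue_eq_zero fun _ _ => rfl⟩
  | succ t ih =>
    obtain ⟨b, hb, hbv⟩ := ih (v := v / 2) (by omega)
    refine ⟨Function.update b (s + t) (decide (v % 2 = 1)), fun i hi => ?_, ?_⟩
    · rw [Function.update_of_ne (by omega), hb i hi]
    · rw [← add_assoc, binaryValue_succ, Function.update_self,
        binaryValue_congr fun i hi => Function.update_of_ne hi.ne _ _, hbv]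
      rcases Nat.mod_two_eq_zero_or_one v with h | h <;> simp [h] <;> omega

/-- The position at which the `n`-th block starts. -/
def blockStart (r : ℕ → ℕ) (n : ℕ) : ℕ := ∑ j ∈ Finset.range n, r j

section Blocks

variable {r t : ℕ → ℕ} {P X Y : ℕ → Bool} {n N : ℕ}

theorem blockStart_succ (r : ℕ → ℕ) (n : ℕ) : blockStart r (n + 1) = blockStart r n + r n :=
  Finset.sum_range_succ _ _

theorem blockStart_mono (r : ℕ → ℕ) : Monotone (blockStart r) :=
  monotone_nat_of_le_succ fun n => by simp [blockStart_succ]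

theorem decode_eq_binaryValue (r : ℕ → ℕ) (X : ℕ → Bool) (n : ℕ) :
    decode r X n = binaryValue (fun i => X (blockStart r n + i)) (r n) := rfl

theorem decode_congr (h : ∀ i < blockStart r (n + 1), X i = Y i) : decode r X n = decode r Y n :=
  binaryValue_congr fun i hi => h _ (by rw [blockStart_succ, ← blockStart]; omega)

theorem eq_of_decode_eq (h : decode r X n = decode r Y n) :
    ∀ i ∈ Finset.Ico (blockStart r n) (blockStart r (n + 1)), X i = Y i := by
  intro i hi
  rw [Finset.mem_Ico, blockStart_succ] at hi
  obtain ⟨j, rfl⟩ := Nat.exists_eq_add_of_le hi.1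
  exact eq_of_binaryValue_eq h j (by omega)

@[fun_prop]
theorem computable_blockStart {α : Type*} [Primcodable α] (hr : Computable r) {n : α → ℕ}
    (hn : Computable n) : Computable fun a => blockStart r (n a) := by
  unfold blockStart
  fun_prop

/-- `P` marks the leading `r n - t n` bits of the `n`-th block for every `n`, so that a sequence
that vanishes on `P` has numbers below `2 ^ t n` in its blocks. -/
structure IsPadding (r t : ℕ → ℕ) (P : ℕ → Bool) : Prop where
  le : ∀ n, t n ≤ r n
  iff : ∀ n, ∀ i < r n, P (blockStart r n + i) = true ↔ i < r n - t n

theorem isPadding_self (r : ℕ → ℕ) : IsPadding r r fun _ => false :=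
  ⟨fun _ => le_rfl, by simp⟩

theorem IsPadding.exists_computable (hr : Computable r) (ht : Computable t) (hle : ∀ n, t n ≤ r n)
    (hpos : ∀ᶠ n in Filter.atTop, 0 < r n) : ∃ P, Computable P ∧ IsPadding r t P := by
  classical
  obtain ⟨n₀, hn₀⟩ := Filter.eventually_atTop.1 hpos
  have hstart (n : ℕ) : n ≤ blockStart r n + n₀ := by
    induction n with
    | zero => exact Nat.zero_le _
    | succ n ih =>
      rw [blockStart_succ]
      rcases Nat.lt_or_ge n n₀ with h | h
      · omega
      · have := hn₀ n h
        omega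
  refine ⟨fun i => decide (∃ n < i + n₀ + 1, blockStart r n ≤ i ∧
    i < blockStart r n + (r n - t n)), computable_decide (by fun_prop), hle, fun n i hi => ?_⟩
  rw [decide_eq_true_eq]
  refine ⟨fun ⟨m, _, hm, hmi⟩ => ?_, fun h => ⟨n, by have := hstart n; omega, by omega, by omega⟩⟩
  rcases lt_trichotomy m n with h | rfl | h
  · have := blockStart_mono r (Nat.succ_le_of_lt h)
    rw [Nat.succ_eq_add_one, blockStart_succ] at this
    omega
  · omega
  · have := blockStart_mono r (Nat.succ_le_of_lt h)
    rw [Nat.succ_eq_add_one, blockStart_succ] at this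
    omega

theorem IsPadding.decode_lt (hP : IsPadding r t P) (hX : ∀ i, P i = true → X i = false) :
    decode r X n < 2 ^ t n := by
  rw [decode_eq_binaryValue, ← Nat.sub_add_cancel (hP.le n)]
  exact binaryValue_add_lt (fun i hi => hX _ ((hP.iff n i (by omega)).2 hi)) _

theorem IsPadding.exists_decode_eq (hP : IsPadding r t P) {v : ℕ → ℕ} (hv : ∀ n, v n < 2 ^ t n)
    (N : ℕ) : ∃ τ : ℕ → Bool, (∀ n < N, decode r τ n = v n) ∧
      ∀ i < blockStart r N, P i = true → τ i = false := by
  induction N with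
  | zero => exact ⟨fun _ => false, by simp, fun _ _ _ => rfl⟩
  | succ N ih =>
    obtain ⟨τ, hτ, hτP⟩ := ih
    obtain ⟨b, hb, hbv⟩ := exists_binaryValue_add_eq (r N - t N) (hv N)
    rw [Nat.sub_add_cancel (hP.le N)] at hbv
    refine ⟨fun i => if i < blockStart r N then τ i else b (i - blockStart r N),
      fun n hn => ?_, fun i hi hPi => ?_⟩
    · rcases Nat.lt_succ_iff_lt_or_eq.1 hn with hn | rfl
      · rw [← hτ n hn]
        exact decode_congr fun i hi => if_pos (hi.trans_le (blockStart_mono r hn))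
      · simp [decode_eq_binaryValue, hbv]
    · by_cases h : i < blockStart r N
      · simp only [if_pos h, hτP i h hPi]
      · rw [blockStart_succ] at hi
        obtain ⟨j, rfl⟩ := Nat.exists_eq_add_of_le (not_lt.1 h)
        simpa using hb j ((hP.iff N j (by omega)).1 hPi)

end Blocks

/-! ### Random members of `DNC_q` -/

theorem measure_diff_iUnion_pos {Ω ι : Type*} [MeasurableSpace Ω] [Countable ι] {μ : Measure Ω}
    [IsFiniteMeasure μ] {E : Set Ω} {B : ι → Set Ω} {c : ι → ℝ≥0∞} (hE : μ E ≠ 0)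
    (hB : ∀ n, μ (E ∩ B n) ≤ μ E * c n) (hc : ∑' n, c n < 1) : 0 < μ (E \ ⋃ n, B n) := by
  have hbad : μ (E ∩ ⋃ n, B n) < μ E := calc
    μ (E ∩ ⋃ n, B n) ≤ ∑' n, μ (E ∩ B n) := Set.inter_iUnion E B ▸ measure_iUnion_le _
    _ ≤ μ E * ∑' n, c n := (ENNReal.tsum_le_tsum hB).trans_eq ENNReal.tsum_mul_left
    _ < μ E * 1 := (ENNReal.mul_lt_mul_iff_right hE (measure_ne_top _ _)).2 hc
    _ = μ E := mul_one _
  by_contra! h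
  refine hbad.not_ge ((measure_le_inter_add_sdiff μ E (⋃ n, B n)).trans_eq ?_)
  rw [nonpos_iff_eq_zero.1 h, add_zero]

theorem paddedMeasure_box_inter_box_le (P : ℕ → Bool) {I K : Finset ℕ} (hIK : Disjoint I K)
    (τ τ' : ℕ → Bool) : paddedMeasure P (box I τ ∩ box K τ') ≤
      paddedMeasure P (box I τ) * ∏ i ∈ K, bif P i then 1 else (2 : ℝ≥0∞)⁻¹ := by
  classical
  have hbox : box I τ ∩ box K τ' = box (I ∪ K) fun i => if i ∈ I then τ i else τ' i := by
    have hK (i : ℕ) (hi : i ∈ K) : i ∉ I := fun hi' => Finset.disjoint_left.1 hIK hi' hi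
    ext X
    simp only [box, Set.mem_inter_iff, Set.mem_ofPred_eq, Finset.mem_union]
    refine ⟨fun h i hi => ?_, fun h => ⟨fun i hi => ?_, fun i hi => ?_⟩⟩
    · by_cases hI : i ∈ I
      · simp [hI, h.1]
      · simp [hI, h.2 i (hi.resolve_left hI)]
    · simp [h i (.inl hi), hi]
    · simp [h i (.inr hi), hK i hi]
  rw [hbox, paddedMeasure_box, paddedMeasure_box, Finset.prod_union hIK]
  refine mul_le_mul' (Finset.prod_congr rfl fun i hi => by simp [hi]).le
    (Finset.prod_le_prod' fun i _ => ?_)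
  cases P i
  · exact le_rfl
  · cases (if i ∈ I then τ i else τ' i) <;> simp

theorem ae_eq_false_of_padding (P : ℕ → Bool) :
    ∀ᵐ X ∂paddedMeasure P, ∀ i, P i = true → X i = false := by
  refine ae_all_iff.2 fun i => ?_
  by_cases hi : P i = true
  · have h := paddedMeasure_box P {i} fun _ => true
    rw [Finset.prod_singleton, hi] at h
    filter_upwards [measure_eq_zero_iff_ae_notMem.1 h] with X hX _
    simpa [box] using hX
  · simp [hi]

section Random

variable {r t : ℕ → ℕ} {P : ℕ → Bool}

theorem IsPadding.prod_block (hP : IsPadding r t P) (n : ℕ) :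
    ∏ i ∈ Finset.Ico (blockStart r n) (blockStart r (n + 1)),
      (bif P i then 1 else (2 : ℝ≥0∞)⁻¹) = 2⁻¹ ^ t n := by
  calc _ = ∏ i ∈ Finset.range (r n), if i < r n - t n then 1 else (2 : ℝ≥0∞)⁻¹ := by
        rw [Finset.prod_Ico_eq_prod_range, blockStart_succ, Nat.add_sub_cancel_left]
        refine Finset.prod_congr rfl fun i hi => ?_
        simp only [← hP.iff n i (Finset.mem_range.1 hi), Bool.cond_eq_ite]
    _ = ∏ i ∈ Finset.range (r n - t n + t n), if i < r n - t n then 1 else (2 : ℝ≥0∞)⁻¹ := by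
        rw [Nat.sub_add_cancel (hP.le n)]
    _ = 2⁻¹ ^ t n := by
        rw [Finset.prod_range_add, Finset.prod_eq_one fun i hi => if_pos (Finset.mem_range.1 hi)]
        simp

theorem IsPadding.measure_inter_decode_mem_le (hP : IsPadding r t P) {n N : ℕ} (hN : N ≤ n)
    (τ : ℕ → Bool) (o : Part ℕ) :
    paddedMeasure P (box (Finset.range (blockStart r N)) τ ∩ {X | decode r X n ∈ o}) ≤
      paddedMeasure P (box (Finset.range (blockStart r N)) τ) * 2⁻¹ ^ t n := by
  rcases Set.eq_empty_or_nonempty {X | decode r X n ∈ o} with h | ⟨Y, hY⟩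
  · simp [h]
  have hdisj : Disjoint (Finset.range (blockStart r N))
      (Finset.Ico (blockStart r n) (blockStart r (n + 1))) := by
    have := blockStart_mono r hN
    refine Finset.disjoint_left.2 fun i hi hi' => ?_
    rw [Finset.mem_range] at hi
    rw [Finset.mem_Ico] at hi'
    omega
  have hsub : {X | decode r X n ∈ o} ⊆
      box (Finset.Ico (blockStart r n) (blockStart r (n + 1))) Y :=
    fun X hX => eq_of_decode_eq (Part.mem_unique hX hY)
  rw [← hP.prod_block n]
  exact (measure_mono (Set.inter_subset_inter_right _ hsub)).trans
    (paddedMeasure_box_inter_box_le P hdisj τ Y)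

/-- Beyond some block `N` the probabilities of hitting `ψ n` add up to less than `1`, so we only
have to prescribe suitable values for the finitely many blocks before `N`. -/
theorem IsPadding.measure_decode_notMem_pos (hP : IsPadding r t P) {ψ : ℕ →. ℕ}
    (hψ : ∀ n, ∃ v < 2 ^ t n, v ∉ ψ n) (hsum : ∑' n, (2 : ℝ≥0∞)⁻¹ ^ t n ≠ ∞) :
    0 < paddedMeasure P {X | ∀ n, decode r X n ∉ ψ n ∧ decode r X n < 2 ^ t n} := by
  choose v hv hvψ using hψ
  obtain ⟨N, hN⟩ : ∃ N, ∑' n, (2 : ℝ≥0∞)⁻¹ ^ t (n + N) < 1 :=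
    ((ENNReal.tendsto_sum_nat_add (fun n => (2 : ℝ≥0∞)⁻¹ ^ t n) hsum).eventually_lt_const
      zero_lt_one).exists
  obtain ⟨τ, hτ, hτP⟩ := hP.exists_decode_eq hv N
  let E := box (Finset.range (blockStart r N)) τ
  have hE : paddedMeasure P E ≠ 0 := by
    rw [paddedMeasure_box, Finset.prod_ne_zero_iff]
    intro i hi
    cases h : P i
    · simp
    · simp [hτP i (Finset.mem_range.1 hi) h]
  refine (measure_diff_iUnion_pos hE (fun n => hP.measure_inter_decode_mem_le
    (Nat.le_add_left N n) τ (ψ (n + N))) hN).trans_le (measure_mono_ae ?_)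
  filter_upwards [ae_eq_false_of_padding P] with X hX ⟨hXE, hXψ⟩ n
  refine ⟨?_, hP.decode_lt hX⟩
  rcases lt_or_ge n N with hn | hn
  · have hXτ : decode r X n = decode r τ n := decode_congr fun i hi =>
      hXE i (Finset.mem_range.2 (hi.trans_le (blockStart_mono r hn)))
    rw [hXτ, hτ n hn]
    exact hvψ n
  · obtain ⟨m, rfl⟩ := Nat.exists_eq_add_of_le' hn
    exact fun h => hXψ (Set.mem_iUnion.2 ⟨m, h⟩)

end Random

theorem exists_lt_two_pow_log_notMem {o : Part ℕ} {a b : ℕ} (hab : a < b) (ha : a ∉ o) :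
    ∃ v < 2 ^ Nat.log 2 b, v ∉ o := by
  rcases Nat.lt_or_ge b 2 with hb | hb
  · exact ⟨a, by have := Nat.two_pow_pos (Nat.log 2 b); omega, ha⟩
  · have h2 : 2 ^ 1 ≤ 2 ^ Nat.log 2 b :=
      Nat.pow_le_pow_right two_pos (Nat.log_pos one_lt_two hb)
    by_cases h0 : 0 ∈ o
    · exact ⟨1, by omega, fun h1 => zero_ne_one (Part.mem_unique h0 h1)⟩
    · exact ⟨0, by omega, h0⟩

theorem tsum_inv_two_pow_log_ne_top {q : ℕ → ℕ} (hq : ∀ n, q n ≠ 0)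
    (hs : Summable fun n => 1 / (q n : ℝ)) : ∑' n, (2 : ℝ≥0∞)⁻¹ ^ Nat.log 2 (q n) ≠ ∞ := by
  have hle (n : ℕ) : (2 : ℝ)⁻¹ ^ Nat.log 2 (q n) ≤ 2 * (1 / q n) := by
    have hlog : (q n : ℝ) < 2 ^ (Nat.log 2 (q n) + 1) := by
      exact_mod_cast Nat.lt_pow_succ_log_self one_lt_two (q n)
    have hqn : (0 : ℝ) < q n := by exact_mod_cast Nat.pos_of_ne_zero (hq n)
    rw [inv_pow, mul_one_div, inv_le_comm₀ (by positivity) (by positivity), inv_div,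
      div_le_iff₀ two_pos, ← pow_succ]
    exact hlog.le
  have h := (Summable.of_nonneg_of_le (fun n => by positivity) hle
    (hs.mul_left 2)).tsum_ofReal_ne_top
  simpa only [ENNReal.ofReal_pow (inv_nonneg.2 zero_le_two), ENNReal.ofReal_inv_of_pos two_pos,
    ENNReal.ofReal_ofNat] using h

section DNCRandom

variable {φ : ℕ → ℕ →. ℕ} {q r : ℕ → ℕ} {P : ℕ → Bool}

theorem IsPadding.measure_decode_mem_DNC_pos (hP : IsPadding r (fun n => Nat.log 2 (q n)) P)
    (hs : Summable fun n => 1 / (q n : ℝ)) (hne : (DNC φ q).Nonempty) :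
    0 < paddedMeasure P {X | decode r X ∈ DNC φ q} := by
  obtain ⟨f, hf⟩ := hne
  have hq (n : ℕ) : q n ≠ 0 := (Nat.zero_le _).trans_lt (hf n).2 |>.ne'
  refine (hP.measure_decode_notMem_pos (ψ := J φ)
    (fun n => exists_lt_two_pow_log_notMem (hf n).2 (hf n).1)
    (tsum_inv_two_pow_log_ne_top hq hs)).trans_le (measure_mono fun X hX n => ?_)
  exact ⟨(hX n).1, (hX n).2.trans_le (Nat.pow_log_le_self 2 (hq n))⟩

theorem not_isTTNegligible_DNCClass (hq : Computable q) (hs : Summable fun n => 1 / (q n : ℝ))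
    (hne : (DNC φ q).Nonempty) : ¬ IsTTNegligible (DNCClass φ q) := by
  have hev : ∀ᶠ n in Filter.atTop, 0 < Nat.clog 2 (q n) := by
    filter_upwards [hs.tendsto_atTop_zero.eventually_lt_const one_pos] with n hn
    obtain ⟨f, hf⟩ := hne
    refine Nat.clog_pos one_lt_two ((Nat.two_le_iff _).2 ⟨?_, fun h => by simp [h] at hn⟩)
    exact (Nat.zero_le _).trans_lt (hf n).2 |>.ne'
  obtain ⟨P, hPc, hP⟩ := IsPadding.exists_computable (computable_natClog one_lt_two hq)
    (computable_natLog one_lt_two hq) (fun n => Nat.log_le_clog 2 (q n)) hev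
  exact fun h => (hP.measure_decode_mem_DNC_pos hs hne).ne'
    (h _ inferInstance (isComputableMeasure_paddedMeasure hPc))

theorem uniformMeasure_decode_mem_DNC_pos (hs : Summable fun n => 1 / (q n : ℝ))
    (hne : (DNC φ q).Nonempty) :
    0 < uniformMeasure {X | decode (fun n => Nat.log 2 (q n)) X ∈ DNC φ q} :=
  (isPadding_self _).measure_decode_mem_DNC_pos hs hne

end DNCRandom

/-! ### The a priori probability of a level -/

theorem prefix_or_prefix_of_mem_universalFunctional {X : ℕ → Bool} {m n : ℕ} {τ τ' : List Bool}
    (h : (restrict X m, τ) ∈ universalFunctional) (h' : (restrict X n, τ') ∈ universalFunctional) :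
    τ <+: τ' ∨ τ' <+: τ := by
  rcases le_total m n with hmn | hmn
  · exact isConsistent_universalFunctional _ h _ h' (restrict_prefix X hmn)
  · exact (isConsistent_universalFunctional _ h' _ h (restrict_prefix X hmn)).symm

theorem measurableSet_outputExtends (Φ : Set (List Bool × List Bool)) (σ : List Bool) :
    MeasurableSet {X | OutputExtends Φ X σ} := by
  by_cases h : σ = []
  · simp [OutputExtends, h]
  · simp only [OutputExtends, h, false_or]
    exact measurableSet_exists_restrict fun α => ∃ τ, (α, τ) ∈ Φ ∧ σ <+: τ

theorem eq_of_outputExtends {X : ℕ → Bool} {σ σ' : List Bool} (hlen : σ.length = σ'.length)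
    (h : OutputExtends universalFunctional X σ) (h' : OutputExtends universalFunctional X σ') :
    σ = σ' := by
  rcases h with rfl | ⟨m, τ, hτ, hσ⟩
  · exact (List.length_eq_zero_iff.1 hlen.symm).symm
  rcases h' with rfl | ⟨m', τ', hτ', hσ'⟩
  · exact List.length_eq_zero_iff.1 hlen
  obtain ⟨ρ, hρ, hρ'⟩ : ∃ ρ, σ <+: ρ ∧ σ' <+: ρ := by
    rcases prefix_or_prefix_of_mem_universalFunctional hτ hτ' with h | h
    · exact ⟨τ', hσ.trans h, hσ'⟩
    · exact ⟨τ, hσ, hσ'.trans h⟩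
  exact (List.prefix_of_prefix_length_le hρ hρ' hlen.le).eq_of_length hlen

theorem tsum_aprioriM_level (T : Set (List Bool)) (n : ℕ) :
    ∑' σ : level T n, aprioriM σ =
      uniformMeasure {X | ∃ σ ∈ level T n, OutputExtends universalFunctional X σ} := by
  have hUnion : {X | ∃ σ ∈ level T n, OutputExtends universalFunctional X σ} =
      ⋃ σ : level T n, {X | OutputExtends universalFunctional X σ} := by
    ext X
    simp
  have hdisj : Pairwise fun σ σ' : level T n =>
      Disjoint {X | OutputExtends universalFunctional X σ}
        {X | OutputExtends universalFunctional X σ'} := fun σ σ' hne =>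
    Set.disjoint_left.2 fun X hX hX' =>
      hne (Subtype.ext (eq_of_outputExtends (σ.2.2.trans σ'.2.2.symm) hX hX'))
  rw [hUnion, measure_iUnion hdisj fun σ => measurableSet_outputExtends _ _]
  rfl

/-! ### `DNC_q` as a `Π⁰₁` class -/

@[fun_prop]
theorem computable_decode {α : Type*} [Primcodable α] {r : ℕ → ℕ} {X : α → ℕ → Bool} {n : α → ℕ}
    (hr : Computable r) (hX : Computable fun x : α × ℕ => X x.1 x.2) (hn : Computable n) :
    Computable fun a => decode r (X a) (n a) := by
  have htoNat : Computable Bool.toNat := (Primrec.dom_bool _).to_comp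
  simp only [decode_eq_binaryValue, binaryValue]
  fun_prop

@[fun_prop]
theorem rePred_mem_J {α : Type*} [Primcodable α] {φ : ℕ → ℕ →. ℕ} (hφ : Partrec₂ φ) {n v : α → ℕ}
    (hn : Computable n) (hv : Computable v) : REPred fun a => v a ∈ J φ (n a) := by
  refine REPred.of_eq (p := fun a => ∃ e y, n a = 2 ^ e * (2 * y + 1) ∧ v a ∈ φ e y)
    (by fun_prop) fun a => ⟨?_, fun h => ?_⟩
  · rintro ⟨e, y, hn, h⟩
    rwa [hn, J_apply]
  · have hn : n a ≠ 0 := by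
      intro h0
      simp [h0, J_zero] at h
    obtain ⟨e, _, ⟨y, rfl⟩, hn⟩ := Nat.exists_eq_two_pow_mul_odd hn
    exact ⟨e, y, hn, by rwa [hn, J_apply] at h⟩

theorem isPi01_DNCClass {φ : ℕ → ℕ →. ℕ} (hφ : Partrec₂ φ) {q : ℕ → ℕ} (hq : Computable q) :
    IsPi01 (DNCClass φ q) := by
  let r (n : ℕ) : ℕ := Nat.clog 2 (q n)
  have hr : Computable r := computable_natClog one_lt_two hq
  have hS : REPred fun σ : List Bool => ∃ n, blockStart r (n + 1) ≤ σ.length ∧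
      (decode r (extendByZeros σ) n ∈ J φ n ∨ q n ≤ decode r (extendByZeros σ) n) := by fun_prop
  refine ⟨_, hS, Set.ext fun X => ?_⟩
  have hdecode {σ : List Bool} {n : ℕ} (hX : X ∈ cylinder σ)
      (hn : blockStart r (n + 1) ≤ σ.length) :
      decode r X n = decode r (extendByZeros σ) n :=
    decode_congr fun i hi => mem_cylinder_iff.1 hX i (hi.trans_le hn)
  have hcompl : X ∈ (DNCClass φ q)ᶜ ↔ ∃ n, decode r X n ∈ J φ n ∨ q n ≤ decode r X n := by
    simp only [Set.mem_compl_iff, DNCClass, DNC, Set.mem_ofPred_eq, not_forall, not_and_or,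
      not_not, not_lt, r]
  simp only [hcompl, Set.mem_iUnion, exists_prop]
  constructor
  · rintro ⟨n, hn⟩
    have hX := restrict_mem_cylinder X (blockStart r (n + 1))
    have hlen := (restrict_length X (blockStart r (n + 1))).ge
    exact ⟨_, ⟨n, hlen, hdecode hX hlen ▸ hn⟩, hX⟩
  · rintro ⟨σ, ⟨n, hlen, hn⟩, hX⟩
    exact ⟨n, hdecode hX hlen ▸ hn⟩

/-! ### Diagonalization against a random partial function -/

section Diagonalization

variable {μ : Measure (ℕ → Bool)} {G : List Bool → ℕ → ℕ → Prop} {w : ℕ →. ℕ} {Q : ℕ → ℕ}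
  {c : ℝ≥0∞} {m : ℕ}

/-- The event that `w`, by taking the value `v` at `j`, is the first to agree with the random
partial function whose graph at `X` is enumerated by `G` along the initial segments of `X`: this
function has the value `v` at `j` and differs from `w` at all smaller arguments. -/
def killedSet (G : List Bool → ℕ → ℕ → Prop) (w : ℕ →. ℕ) (j v : ℕ) : Set (ℕ → Bool) :=
  {X | ∃ n, G (restrict X n) j v ∧ ∀ i < j, ∃ u t, G (restrict X n) i u ∧ t ∈ w i ∧ u ≠ t}

/-- The event that the random partial function enumerated by `G` has values below `Q` that avoid
`w` at all arguments below `m`. -/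
def survivorSet (G : List Bool → ℕ → ℕ → Prop) (w : ℕ →. ℕ) (Q : ℕ → ℕ) (m : ℕ) :
    Set (ℕ → Bool) :=
  {X | ∃ n, ∀ j < m, ∃ u < Q j, G (restrict X n) j u ∧ u ∉ w j}

/-- `w` kills, at each argument `j`, a value with `μ`-probability above `1 / (c * Q j)` whenever
there is such a value, and is undefined otherwise. -/
structure IsKiller (μ : Measure (ℕ → Bool)) (G : List Bool → ℕ → ℕ → Prop) (Q : ℕ → ℕ) (c : ℝ≥0∞)
    (w : ℕ →. ℕ) : Prop where
  inv_lt : ∀ j, ∀ v ∈ w j, (Q j : ℝ≥0∞)⁻¹ < c * μ (killedSet G w j v)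
  dom : ∀ j v, (Q j : ℝ≥0∞)⁻¹ < c * μ (killedSet G w j v) → (w j).Dom

theorem survivorSet_subset_iUnion_killedSet {j : ℕ} (hj : j < m) (hdom : ∀ i < j, (w i).Dom) :
    survivorSet G w Q m ⊆ ⋃ u ∈ Finset.range (Q j), killedSet G w j u := by
  rintro X ⟨n, hn⟩
  obtain ⟨u, hu, hGu, -⟩ := hn j hj
  refine Set.mem_biUnion (Finset.mem_coe.2 (Finset.mem_range.2 hu)) ⟨n, hGu, fun i hi => ?_⟩
  obtain ⟨u', -, hGu', hu'⟩ := hn i (hi.trans hj)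
  have ht := Part.get_mem (hdom i hi)
  exact ⟨u', _, hGu', ht, fun h => hu' (h ▸ ht)⟩

theorem measurableSet_killedSet (j v : ℕ) : MeasurableSet (killedSet G w j v) :=
  measurableSet_exists_restrict fun α =>
    G α j v ∧ ∀ i < j, ∃ u t, G α i u ∧ t ∈ w i ∧ u ≠ t

theorem disjoint_killedSet
    (hG : ∀ X n n' j v v', G (restrict X n) j v → G (restrict X n') j v' → v = v') {i j v v' : ℕ}
    (hij : i < j) (hv : v ∈ w i) : Disjoint (killedSet G w i v) (killedSet G w j v') := by
  refine Set.disjoint_left.2 fun X ⟨n, hn, _⟩ ⟨n', _, hn'⟩ => ?_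
  obtain ⟨u, t, hu, ht, hne⟩ := hn' i hij
  exact hne ((hG X _ _ _ _ _ hu hn).trans (Part.mem_unique hv ht))

/-- At the first argument where `w` is undefined all values have small probability, but together
they cover the survivors. -/
theorem IsKiller.dom_of_lt (hw : IsKiller μ G Q c w) (hlarge : 1 < c * μ (survivorSet G w Q m)) :
    ∀ j < m, (w j).Dom := by
  intro j
  induction j using Nat.strong_induction_on with
  | _ j ih =>
  intro hj
  by_contra hundef
  have hsmall (u : ℕ) : c * μ (killedSet G w j u) ≤ (Q j : ℝ≥0∞)⁻¹ :=
    not_lt.1 fun h => hundef (hw.dom j u h)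
  have hcover := survivorSet_subset_iUnion_killedSet (G := G) (Q := Q) hj
    fun i hi => ih i hi (hi.trans hj)
  refine hlarge.not_ge ?_
  calc c * μ (survivorSet G w Q m)
      ≤ c * ∑ u ∈ Finset.range (Q j), μ (killedSet G w j u) := by
        gcongr
        exact (measure_mono hcover).trans (measure_biUnion_finset_le _ _)
    _ ≤ ∑ _u ∈ Finset.range (Q j), (Q j : ℝ≥0∞)⁻¹ := by
        rw [Finset.mul_sum]
        exact Finset.sum_le_sum fun u _ => hsmall u
    _ ≤ 1 := by
        simp

/-- If the survivors had probability above `1 / c`, the events killed at `0, …, m - 1` would be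
disjoint and have total probability above `1`. -/
theorem IsKiller.measure_survivorSet_le [IsProbabilityMeasure μ] (hw : IsKiller μ G Q c w)
    (hG : ∀ X n n' j v v', G (restrict X n) j v → G (restrict X n') j v' → v = v')
    (hm : c < ∑ j ∈ Finset.range m, (Q j : ℝ≥0∞)⁻¹) : μ (survivorSet G w Q m) ≤ c⁻¹ := by
  rw [ENNReal.le_inv_iff_mul_le, mul_comm]
  by_contra! hlarge
  choose! v hv using fun j hj => Part.dom_iff_mem.1 (hw.dom_of_lt hlarge j hj)
  have hdisj : Set.PairwiseDisjoint (Finset.range m : Set ℕ) fun j => killedSet G w j (v j) := by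
    intro i hi j hj hne
    rw [Finset.mem_coe, Finset.mem_range] at hi hj
    rcases hne.lt_or_gt with h | h
    · exact disjoint_killedSet hG h (hv i hi)
    · exact (disjoint_killedSet hG h (hv j hj)).symm
  refine hm.not_ge ?_
  calc ∑ j ∈ Finset.range m, (Q j : ℝ≥0∞)⁻¹
      ≤ ∑ j ∈ Finset.range m, c * μ (killedSet G w j (v j)) :=
        Finset.sum_le_sum fun j hj => (hw.inv_lt j _ (hv j (Finset.mem_range.1 hj))).le
    _ = c * μ (⋃ j ∈ Finset.range m, killedSet G w j (v j)) := by
        rw [← Finset.mul_sum,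
          measure_biUnion_finset hdisj fun j _ => measurableSet_killedSet j (v j)]
    _ ≤ c := mul_le_of_le_one_right' prob_le_one

end Diagonalization

/-- The argument at which `J` has the value of `φ e` at `j`. -/
def node (e j : ℕ) : ℕ := 2 ^ e * (2 * j + 1)

@[fun_prop]
theorem computable_node {α : Type*} [Primcodable α] {f g : α → ℕ} (hf : Computable f)
    (hg : Computable g) : Computable fun a => node (f a) (g a) := by
  unfold node
  fun_prop

theorem J_node (φ : ℕ → ℕ →. ℕ) (e j : ℕ) : J φ (node e j) = φ e j := J_apply φ e j

theorem node_strictMono (e : ℕ) : StrictMono (node e) := fun i j hij => by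
  unfold node
  gcongr

section Killing

variable {φ : ℕ → ℕ →. ℕ} {q : ℕ → ℕ} {G : List Bool → ℕ → ℕ → Prop}

theorem rePred_lt_mul_uniformMeasure_killedSet (hφ : Partrec₂ φ) (hq : Computable q)
    (hG : REPred fun x : List Bool × ℕ × ℕ => G x.1 x.2.1 x.2.2) :
    REPred fun x : (ℕ × ℕ × ℕ) × ℕ =>
      ((1 : ℕ) : ℝ≥0∞) < (q (node x.1.2.1 x.1.2.2) * 2 ^ x.1.1 : ℕ) *
        uniformMeasure (killedSet (fun α i => G α (node x.1.2.1 i)) (φ x.1.2.1) x.1.2.2 x.2) := by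
  let B (x : (ℕ × ℕ × ℕ) × ℕ) (α : List Bool) : Prop := G α (node x.1.2.1 x.1.2.2) x.2 ∧
    ∀ i < x.1.2.2, ∃ u t, G α (node x.1.2.1 i) u ∧ t ∈ φ x.1.2.1 i ∧ u ≠ t
  have hB : REPred fun x : ((ℕ × ℕ × ℕ) × ℕ) × List Bool => B x.1 x.2 := by
    simp only [B]
    fun_prop
  exact rePred_lt_mul_uniformMeasure (m := fun _ => 1)
    (c := fun x : (ℕ × ℕ × ℕ) × ℕ => q (node x.1.2.1 x.1.2.2) * 2 ^ x.1.1) hB (by fun_prop)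
    (by fun_prop)

/-- By the recursion theorem, `φ (e k)` may search for values to kill at the arguments of `J` that
it controls itself. -/
theorem exists_computable_isKiller (hφ : IsStandardEnumeration φ) (hq : Computable q)
    (hG : REPred fun x : List Bool × ℕ × ℕ => G x.1 x.2.1 x.2.2) :
    ∃ e, Computable e ∧ ∀ k, IsKiller uniformMeasure (fun α j => G α (node (e k) j))
      (fun j => q (node (e k) j)) (2 ^ k) (φ (e k)) := by
  obtain ⟨f, hf, hsound, hdom⟩ :=
    exists_partrec_selector (R := fun (x : ℕ × ℕ × ℕ) v => ((1 : ℕ) : ℝ≥0∞) <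
      (q (node x.2.1 x.2.2) * 2 ^ x.1 : ℕ) * uniformMeasure
        (killedSet (fun α i => G α (node x.2.1 i)) (φ x.2.1) x.2.2 v))
      (rePred_lt_mul_uniformMeasure_killedSet hφ.1 hq hG)
  obtain ⟨e, he, hφe⟩ := hφ.exists_computable_fixedPoint (ψ := fun k e j => f (k, e, j)) hf
  have hiff (a k : ℕ) (x : ℝ≥0∞) :
      ((1 : ℕ) : ℝ≥0∞) < (a * 2 ^ k : ℕ) * x ↔ (a : ℝ≥0∞)⁻¹ < 2 ^ k * x := by
    rw [← not_le, ← not_le, ENNReal.le_inv_iff_mul_le]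
    push_cast
    rw [mul_rotate, mul_rotate, mul_rotate, mul_comm (a : ℝ≥0∞), mul_right_comm]
  simp only [hiff] at hsound hdom
  refine ⟨e, he, fun k => ⟨fun j v hv => hsound (k, e k, j) v ?_, fun j v hv => ?_⟩⟩
  · rwa [← congrFun (hφe k) j]
  · rw [congrFun (hφe k) j]
    exact (hdom (k, e k, j)).2 ⟨v, hv⟩

end Killing

/-! ### Divergence along the nodes -/

theorem tsum_inv_node_eq_top {q : ℕ → ℕ} (hq : Monotone q) (hq0 : ∀ n, q n ≠ 0)
    (hs : ¬ Summable fun n => 1 / (q n : ℝ)) (e : ℕ) :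
    ∑' j, (q (node e j) : ℝ≥0∞)⁻¹ = ∞ := by
  have hanti : Antitone fun n => 1 / (q n : ℝ) := fun a b hab =>
    one_div_le_one_div_of_le (by exact_mod_cast Nat.pos_of_ne_zero (hq0 a))
      (by exact_mod_cast hq hab)
  have hnode : ¬ Summable fun j => 1 / (q (node e j) : ℝ) := by
    have hlin (j : ℕ) : node e j = 2 ^ (e + 1) * j + 2 ^ e := by
      unfold node
      ring
    simp only [hlin]
    rwa [← summable_indicator_mod_iff_summable _ _ fun n => 1 / (q n : ℝ),
      summable_indicator_mod_iff hanti]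
  by_contra hfin
  refine hnode ((ENNReal.summable_toReal hfin).congr fun j => ?_)
  simp

theorem computablePred_natCast_lt_sum_inv {α : Type*} [Primcodable α] {c n : α → ℕ}
    {Q : α → ℕ → ℕ} (hc : Computable c) (hn : Computable n)
    (hQ : Computable fun x : α × ℕ => Q x.1 x.2) (hQ0 : ∀ a j, Q a j ≠ 0) :
    ComputablePred fun a => (c a : ℝ≥0∞) < ∑ j ∈ Finset.range (n a), (Q a j : ℝ≥0∞)⁻¹ := by
  let D (a : α) : ℕ := ∏ j ∈ Finset.range (n a), Q a j
  refine ComputablePred.of_eq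
    (p := fun a => c a * D a < ∑ j ∈ Finset.range (n a), D a / Q a j) (by fun_prop) fun a => ?_
  have hD : (D a : ℝ≥0∞) ≠ 0 := by
    exact_mod_cast Finset.prod_ne_zero_iff.2 fun j _ => hQ0 a j
  have hdiv : ∀ j ∈ Finset.range (n a), ((D a / Q a j : ℕ) : ℝ≥0∞) = (Q a j : ℝ≥0∞)⁻¹ * D a := by
    intro j hj
    have hmul : D a / Q a j * Q a j = D a := Nat.div_mul_cancel (Finset.dvd_prod_of_mem _ hj)
    rw [mul_comm, ← div_eq_mul_inv, ENNReal.eq_div_iff (by exact_mod_cast hQ0 a j) (by simp)]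
    exact_mod_cast (mul_comm _ _).trans hmul
  rw [← Nat.cast_lt (α := ℝ≥0∞), Nat.cast_sum, Finset.sum_congr rfl hdiv, ← Finset.sum_mul,
    Nat.cast_mul, ENNReal.mul_lt_mul_iff_left hD (by simp)]

theorem exists_computable_two_pow_lt_sum_inv_node {q : ℕ → ℕ} (hqc : Computable q)
    (hq : Monotone q) (hq0 : ∀ n, q n ≠ 0) (hs : ¬ Summable fun n => 1 / (q n : ℝ)) {e : ℕ → ℕ}
    (he : Computable e) : ∃ m : ℕ → ℕ, Computable m ∧
      ∀ k, (2 : ℝ≥0∞) ^ k < ∑ j ∈ Finset.range (m k), (q (node (e k) j) : ℝ≥0∞)⁻¹ := by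
  have hp : ComputablePred fun x : ℕ × ℕ => ((2 ^ x.1 : ℕ) : ℝ≥0∞) <
      ∑ j ∈ Finset.range x.2, (q (node (e x.1) j) : ℝ≥0∞)⁻¹ :=
    computablePred_natCast_lt_sum_inv (c := fun x : ℕ × ℕ => 2 ^ x.1) (n := fun x => x.2)
      (Q := fun x j => q (node (e x.1) j)) (by fun_prop) (by fun_prop) (by fun_prop)
      fun _ _ => hq0 _
  have hex (k : ℕ) : ∃ n, ((2 ^ k : ℕ) : ℝ≥0∞) <
      ∑ j ∈ Finset.range n, (q (node (e k) j) : ℝ≥0∞)⁻¹ := by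
    refine (ENNReal.tendsto_nat_tsum _ |>.eventually_const_lt ?_).exists
    rw [tsum_inv_node_eq_top hq hq0 hs]
    exact ENNReal.natCast_lt_top _
  obtain ⟨m, hm, hlt⟩ := exists_computable_choice (p := fun k n => ((2 ^ k : ℕ) : ℝ≥0∞) <
    ∑ j ∈ Finset.range n, (q (node (e k) j) : ℝ≥0∞)⁻¹) hp hex
  exact ⟨m, hm, fun k => by exact_mod_cast hlt k⟩

/-! ### Depth of `DNC_q` -/

theorem exists_computable_order_le {L : ℕ → ℕ} (hL : Computable L) :
    ∃ h : ℕ → ℕ, Computable h ∧ IsOrder h ∧ ∀ n, h n ≠ 0 → L (h n) ≤ n := by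
  refine ⟨fun n => Nat.findGreatest (fun k => L k ≤ n) n, ?_,
    ⟨fun a b hab => Nat.findGreatest_mono (fun k hk => hk.trans hab) hab, fun b => ?_⟩,
    fun n hn => Nat.findGreatest_of_ne_zero (P := fun k => L k ≤ n) rfl hn⟩
  · refine computable_of_computablePred_le (ComputablePred.of_eq
      (p := fun x : ℕ × ℕ => ∀ k < x.1 + 1, ¬ L k ≤ x.1 ∨ k ≤ x.2) (by fun_prop) fun x => ?_)
    refine ⟨fun H => ?_, fun H k hk => ?_⟩
    · rcases eq_or_ne (Nat.findGreatest (fun k => L k ≤ x.1) x.1) 0 with h0 | h0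
      · exact h0 ▸ Nat.zero_le _
      · exact (H _ (Nat.lt_succ_of_le (Nat.findGreatest_le _))).resolve_left
          (not_not.2 (Nat.findGreatest_of_ne_zero (P := fun k => L k ≤ x.1) rfl h0))
    · exact imp_iff_not_or.1 fun hLk =>
        (Nat.le_findGreatest (Nat.lt_succ_iff.1 hk) hLk).trans H
  · exact ⟨max (L (b + 1)) (b + 1), Nat.lt_of_succ_le
      (Nat.le_findGreatest (le_max_right _ _) (le_max_left _ _))⟩

/-- The universal functional `Φ̂` maps `α` to a string that is long enough to determine the value
at `n` of the function it codes, which is `v`. -/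
def DecodedOutput (r : ℕ → ℕ) (α : List Bool) (n v : ℕ) : Prop :=
  ∃ τ, (α, τ) ∈ universalFunctional ∧ blockStart r (n + 1) ≤ τ.length ∧
    decode r (extendByZeros τ) n = v

theorem rePred_decodedOutput {r : ℕ → ℕ} (hr : Computable r) :
    REPred fun x : List Bool × ℕ × ℕ => DecodedOutput r x.1 x.2.1 x.2.2 := by
  unfold DecodedOutput
  fun_prop

theorem decode_extendByZeros_of_prefix {r : ℕ → ℕ} {σ τ : List Bool} {n : ℕ} (h : σ <+: τ)
    (hn : blockStart r (n + 1) ≤ σ.length) :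
    decode r (extendByZeros σ) n = decode r (extendByZeros τ) n := by
  refine decode_congr fun i hi => ?_
  obtain ⟨ρ, rfl⟩ := h
  exact (List.getD_append _ _ _ _ (hi.trans_le hn)).symm

theorem decodedOutput_unique {r : ℕ → ℕ} {X : ℕ → Bool} {m m' n v v' : ℕ}
    (h : DecodedOutput r (restrict X m) n v) (h' : DecodedOutput r (restrict X m') n v') :
    v = v' := by
  obtain ⟨τ, hτ, hlen, rfl⟩ := h
  obtain ⟨τ', hτ', hlen', rfl⟩ := h'
  rcases prefix_or_prefix_of_mem_universalFunctional hτ hτ' with h | h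
  · exact decode_extendByZeros_of_prefix h hlen
  · exact (decode_extendByZeros_of_prefix h hlen').symm

section Depth

variable {φ : ℕ → ℕ →. ℕ} {q : ℕ → ℕ}

theorem outputExtends_level_subset_survivorSet {e m N : ℕ} (hN : 0 < N)
    (hm : ∀ j < m, blockStart (fun n => Nat.clog 2 (q n)) (node e j + 1) ≤ N) :
    {X | ∃ σ ∈ level (canonicalTree (DNCClass φ q)) N, OutputExtends universalFunctional X σ} ⊆
      survivorSet (fun α j => DecodedOutput (fun n => Nat.clog 2 (q n)) α (node e j)) (φ e)
        (fun j => q (node e j)) m := by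
  rintro X ⟨σ, ⟨⟨Y, hYσ, hY⟩, rfl⟩, rfl | ⟨l, τ, hτ, hp⟩⟩
  · simp at hN
  refine ⟨l, fun j hj => ⟨_, (hY (node e j)).2, ⟨τ, hτ, (hm j hj).trans hp.length_le, ?_⟩, ?_⟩⟩
  · rw [← decode_extendByZeros_of_prefix hp (hm j hj)]
    exact (decode_congr fun i hi => mem_cylinder_iff.1 hYσ i (hi.trans_le (hm j hj))).symm
  · rw [← J_node φ e j]
    exact (hY (node e j)).1

theorem exists_order_level_le (hφ : IsStandardEnumeration φ) (hqc : Computable q)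
    (hq : Monotone q) (hq0 : ∀ n, q n ≠ 0) (hs : ¬ Summable fun n => 1 / (q n : ℝ)) :
    ∃ h : ℕ → ℕ, Computable h ∧ IsOrder h ∧ ∀ n,
      ∑' σ : level (canonicalTree (DNCClass φ q)) n, aprioriM σ ≤ (2 : ℝ≥0∞)⁻¹ ^ h n := by
  let r (n : ℕ) : ℕ := Nat.clog 2 (q n)
  have hr : Computable r := computable_natClog one_lt_two hqc
  obtain ⟨e, he, hkill⟩ := exists_computable_isKiller hφ hqc (rePred_decodedOutput hr)
  obtain ⟨m, hm, hsum⟩ := exists_computable_two_pow_lt_sum_inv_node hqc hq hq0 hs he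
  obtain ⟨h, hhc, hh, hle⟩ := exists_computable_order_le
    (L := fun k => blockStart r (node (e k) (m k)) + 1) (by fun_prop)
  refine ⟨h, hhc, hh, fun n => ?_⟩
  rw [tsum_aprioriM_level]
  by_cases h0 : h n = 0
  · rw [h0, pow_zero]
    exact prob_le_one
  have hlen (j : ℕ) (hj : j < m (h n)) : blockStart r (node (e (h n)) j + 1) ≤ n :=
    (blockStart_mono r (node_strictMono _ hj)).trans ((Nat.le_succ _).trans (hle n h0))
  calc uniformMeasure _ ≤ uniformMeasure (survivorSet _ _ _ (m (h n))) :=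
        measure_mono (outputExtends_level_subset_survivorSet
          ((Nat.succ_pos _).trans_le (hle n h0)) hlen)
    _ ≤ (2 ^ h n)⁻¹ := (hkill (h n)).measure_survivorSet_le
        (fun X _ _ j _ _ => decodedOutput_unique) (hsum (h n))
    _ = 2⁻¹ ^ h n := ENNReal.inv_pow

theorem isDeep_DNCClass (hφ : IsStandardEnumeration φ) (hqc : Computable q) (hq : Monotone q)
    (hs : ¬ Summable fun n => 1 / (q n : ℝ)) : IsDeep (DNCClass φ q) := by
  refine ⟨isPi01_DNCClass hφ.1 hqc, ?_⟩
  by_cases hq0 : ∀ n, q n ≠ 0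
  · exact exists_order_level_le hφ hqc hq hq0 hs
  push Not at hq0
  obtain ⟨n₀, hn₀⟩ := hq0
  have hempty : DNCClass φ q = ∅ :=
    Set.eq_empty_of_forall_notMem fun X hX => (hn₀ ▸ (hX n₀).2).not_ge (Nat.zero_le _)
  refine ⟨id, Computable.id, ⟨monotone_id, fun b => ⟨b + 1, Nat.lt_succ_self b⟩⟩, fun n => ?_⟩
  rw [tsum_aprioriM_level]
  simp [hempty, level, canonicalTree]

end Depth

end DNCDepth

theorem mainTheorem8_general (φ : ℕ → ℕ →. ℕ) (hφ : DNCDepth.IsStandardEnumeration φ)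
    (q : ℕ → ℕ) (hq : Computable q) :
    (Summable (fun n => 1 / (q n : ℝ)) → (DNCDepth.DNC φ q).Nonempty →
      ¬ DNCDepth.IsTTNegligible (DNCDepth.DNCClass φ q) ∧
      0 < DNCDepth.uniformMeasure
        {X | DNCDepth.decode (fun n => Nat.log 2 (q n)) X ∈ DNCDepth.DNC φ q}) ∧
    (Monotone q → ¬ Summable (fun n => 1 / (q n : ℝ)) →
      DNCDepth.IsDeep (DNCDepth.DNCClass φ q)) :=
  ⟨fun hs hne => ⟨DNCDepth.not_isTTNegligible_DNCClass hq hs hne,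
    DNCDepth.uniformMeasure_decode_mem_DNC_pos hs hne⟩,
    fun hmono hs => DNCDepth.isDeep_DNCClass hφ hq hmono hs⟩

theorem mainTheorem8 (φ : ℕ → ℕ →. ℕ) (hφ : DNCDepth.IsStandardEnumeration φ)
    (q : ℕ → ℕ) (hq : Computable q) (hq' : DNCDepth.IsOrder q) :
    (Summable (fun n => 1 / (q n : ℝ)) → (DNCDepth.DNC φ q).Nonempty →
      ¬ DNCDepth.IsTTNegligible (DNCDepth.DNCClass φ q) ∧
      0 < DNCDepth.uniformMeasure
        {X | DNCDepth.decode (fun n => Nat.log 2 (q n)) X ∈ DNCDepth.DNC φ q}) ∧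
    (¬ Summable (fun n => 1 / (q n : ℝ)) →
      DNCDepth.IsDeep (DNCDepth.DNCClass φ q)) :=
  have general := mainTheorem8_general φ hφ q hq
  ⟨general.1, general.2 hq'.1⟩
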